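/- **Theorem 4.2 (Agol).** Let $\mathbb K^3=\{x\in\mathbb R^3: |x|<1\}$ be the Klein model of hyperbolic space, with its metric of curvature $-1$ (one half of the Hilbert metric of the ball). Write $T(a_1,a_2,a_3;b_1,b_2,b_3)$ for a compact hyperbolic tetrahedron with a distinguished vertex $v$ whose dihedral angles are $\pi/a_i$ at the three edges not adjacent to $v$ and $\pi/b_i$ at the three edges adjacent to $v$, where the edge labelled $b_i$ is opposite to the edge labelled $a_i$. Two tetrahedra $T_2=T(2,3,2;2,3,5)$ and $T_4=T(2,3,4;2,3,5)$ can be placed in $\mathbb K^3$ with common vertex $v=0$ and with corresponding faces adjacent to $v$ lying in the same planes, on the same sides. For any such pair, let $\bar\Gamma_j$ be the group generated by the reflections $\tau^j_1,\dots,\tau^j_4$ in the faces of $T_j$ (with corresponding faces having the same index), let $\Gamma_j$ be its subgroup of orientation-preserving elements, and let $M_{\Gamma_j}=\Gamma_j\backslash\mathbb K^3$ with the quotient metric. Then there are a constant $K<1$, which can be taken to be $0.977$, a linear map $h:\mathbb R^3\to\mathbb R^3$ and a map of orbifolds $f:M_{\Gamma_4}\to M_{\Gamma_2}$, that is, one with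 a continuous lift $\tilde f:\mathbb K^3\to\mathbb K^3$ that is equivariant with respect to a homomorphism $\Gamma_4\to\Gamma_2$, such that 1. $h$ sends each vertex of $T_4$ to the corresponding vertex of $T_2$, so that $h(T_4)=T_2$, and $h$ maps $\mathbb K^3$ into itself and is $K$-Lipschitz for the hyperbolic metric; 2. $\tilde f=h$ on $T_4$, and $\tilde f\circ\tau_i^4=\tau_i^2\circ\tilde f$ for $i=1,\dots,4$; 3. $\tilde f$ and $f$ are $K$-Lipschitz, and $f$ has degree $1$ (with respect to the orientations induced from $\mathbb R^3$). -/

import Mathlib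

open scoped RealInnerProductSpace

noncomputable section

namespace Agol

/-- Euclidean three-space. -/
abbrev E3 : Type := EuclideanSpace ℝ (Fin 3)

/-- Minkowski space `ℝ^{3,1}`: a space part in `ℝ³` and a time part in `ℝ`. -/
abbrev Mink : Type := E3 × ℝ

/-- The Minkowski bilinear form, of signature `(3,1)`. -/
def form (x y : Mink) : ℝ := ⟪x.1, y.1⟫ - x.2 * y.2

lemma form_comm (x y : Mink) : form x y = form y x := by
  simp only [form, real_inner_comm x.1 y.1, mul_comm x.2]

/-- The form as a linear functional in its first variable. -/
def formLeft (u : Mink) : Module.Dual ℝ Mink where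
  toFun x := form x u
  map_add' x y := by simp only [form, Prod.fst_add, Prod.snd_add, inner_add_left]; ring
  map_smul' c x := by
    simp only [form, Prod.smul_fst, Prod.smul_snd, real_inner_smul_left, smul_eq_mul,
      RingHom.id_apply]
    ring

lemma formLeft_apply (u x : Mink) : formLeft u x = form x u := rfl

/-- The open forward light cone. -/
def cone : Set Mink := {x | form x x < 0 ∧ 0 < x.2}

/-- The group `O₀(3,1)` of linear automorphisms of Minkowski space that preserve the form and the
forward light cone. -/
def Isom : Subgroup (Mink ≃ₗ[ℝ] Mink) where
  carrier := {A | (∀ x y, form (A x) (A y) = form x y) ∧ ∀ x, A x ∈ cone ↔ x ∈ cone}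
  mul_mem' {A C} hA hC := by
    refine ⟨fun x y => ?_, fun x => ?_⟩
    · simp only [LinearEquiv.mul_apply, hA.1, hC.1]
    · simp only [LinearEquiv.mul_apply, hA.2, hC.2]
  one_mem' := ⟨fun _ _ => rfl, fun _ => Iff.rfl⟩
  inv_mem' {A} hA := by
    have key : ∀ x, A (A⁻¹ x) = x := fun x => by
      rw [← LinearEquiv.mul_apply, mul_inv_cancel]; rfl
    refine ⟨fun x y => ?_, fun x => ?_⟩
    · rw [← hA.1, key, key]
    · rw [← hA.2, key]

/-- The group `SO₀(3,1)` of orientation preserving isometries, as a subgroup of `O₀(3,1)`. -/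
def SIsom : Subgroup Isom := (LinearEquiv.det.comp Isom.subtype).ker

/-- The Klein (projective) model of hyperbolic three-space: the open unit ball of `ℝ³`. -/
def Klein : Type := Metric.ball (0 : E3) 1

namespace Klein

instance : TopologicalSpace Klein := inferInstanceAs (TopologicalSpace (Metric.ball (0 : E3) 1))

/-- The underlying point of `ℝ³`. -/
def val (x : Klein) : E3 := Subtype.val x

lemma norm_val_lt (x : Klein) : ‖x.val‖ < 1 := mem_ball_zero_iff.1 x.property

/-- The point of the Klein model with given coordinates. -/
def mk (x : E3) (hx : ‖x‖ < 1) : Klein := ⟨x, mem_ball_zero_iff.2 hx⟩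

@[ext] lemma ext {x y : Klein} (h : x.val = y.val) : x = y := Subtype.ext h

/-- The Klein model as the slice `{time = 1}` of the forward light cone. -/
def toMink (x : Klein) : Mink := (x.val, 1)

/-- The hyperbolic distance, of curvature `-1`, on the Klein model. It is one half of the Hilbert
metric of the unit ball. -/
def dist (x y : Klein) : ℝ :=
  Real.arcosh ((1 - ⟪x.val, y.val⟫) / √((1 - ‖x.val‖ ^ 2) * (1 - ‖y.val‖ ^ 2)))

lemma toMink_mem_cone (x : Klein) : x.toMink ∈ cone := by
  have h := x.norm_val_lt
  have h0 := norm_nonneg x.val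
  refine ⟨?_, one_pos⟩
  simp only [form, toMink, real_inner_self_eq_norm_sq]
  nlinarith

end Klein

lemma cone_iff {x : Mink} : x ∈ cone ↔ ‖x.1‖ < x.2 := by
  have h0 := norm_nonneg x.1
  simp only [cone, Set.mem_ofPred_eq, form, real_inner_self_eq_norm_sq]
  constructor
  · rintro ⟨h1, h2⟩
    nlinarith
  · intro h
    exact ⟨by nlinarith, by linarith⟩

/-- The central projection of the forward light cone to the Klein model. -/
def proj (x : Mink) (hx : x ∈ cone) : Klein :=
  Klein.mk (x.2⁻¹ • x.1) (by
    have h : 0 < x.2 := hx.2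
    rw [norm_smul, norm_inv, Real.norm_eq_abs, abs_of_pos h, inv_mul_lt_iff₀ h, mul_one]
    exact cone_iff.1 hx)

lemma proj_val (x : Mink) (hx : x ∈ cone) : (proj x hx).val = x.2⁻¹ • x.1 := rfl

lemma proj_toMink (x : Mink) (hx : x ∈ cone) : (proj x hx).toMink = x.2⁻¹ • x := by
  have h : x.2 ≠ 0 := ne_of_gt hx.2
  ext1
  · rfl
  · simp [Klein.toMink, h]

/-- `O₀(3,1)` acts on the Klein model by projective transformations. -/
instance : MulAction Isom Klein where
  smul A x := proj (A.1 x.toMink) ((A.2.2 _).2 x.toMink_mem_cone)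
  one_smul x := by
    apply Klein.ext
    change (1 : ℝ)⁻¹ • x.val = x.val
    simp
  mul_smul A C x := by
    have hC : C.1 x.toMink ∈ cone := (C.2.2 _).2 x.toMink_mem_cone
    have h : (C.1 x.toMink).2 ≠ 0 := ne_of_gt hC.2
    apply Klein.ext
    change (A.1 (C.1 x.toMink)).2⁻¹ • (A.1 (C.1 x.toMink)).1 =
      (A.1 (proj (C.1 x.toMink) hC).toMink).2⁻¹ • (A.1 (proj (C.1 x.toMink) hC).toMink).1
    rw [proj_toMink, map_smul, Prod.smul_snd, Prod.smul_fst, smul_smul, smul_eq_mul, mul_inv,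
      inv_inv, mul_right_comm, mul_inv_cancel₀ h, one_mul]

lemma smul_val (A : Isom) (x : Klein) :
    (A • x).val = (A.1 x.toMink).2⁻¹ • (A.1 x.toMink).1 := rfl

/-- If a forward and another timelike vector have negative product, the other one is forward. -/
lemma mem_cone_of_form_neg {x y : Mink} (hx : x ∈ cone) (hy : form y y < 0)
    (hxy : form x y < 0) : y ∈ cone := by
  refine ⟨hy, ?_⟩
  by_contra hn
  have hn : y.2 ≤ 0 := not_lt.1 hn
  have hx' := cone_iff.1 hx
  have hy' : ‖y.1‖ < -y.2 := by
    have h0 := norm_nonneg y.1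
    simp only [form, real_inner_self_eq_norm_sq] at hy
    nlinarith
  have h := neg_le_of_abs_le (abs_real_inner_le_norm x.1 y.1)
  have h2 : ‖x.1‖ * ‖y.1‖ ≤ x.2 * -y.2 :=
    mul_le_mul hx'.le hy'.le (norm_nonneg _) hx.2.le
  simp only [form] at hxy
  linarith

/-- The hyperbolic reflection `x ↦ x - 2 B(x,u) u` in the plane orthogonal to a vector `u` with
`B(u,u) = 1`. -/
def reflection (u : Mink) (hu : form u u = 1) : Isom :=
  ⟨Module.reflection (x := u) (f := (2 : ℝ) • formLeft u)
      (by simp [formLeft_apply, hu]), by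
    have happ : ∀ x, Module.reflection (x := u) (f := (2 : ℝ) • formLeft u)
        (by simp [formLeft_apply, hu]) x = x - (2 * form x u) • u := fun x => by
      simp [Module.reflection_apply, formLeft_apply]
    have e1 : ∀ x y z, form (x - y) z = form x z - form y z := fun x y z => by
      rw [← formLeft_apply, map_sub]; rfl
    have e2 : ∀ (c : ℝ) x z, form (c • x) z = c * form x z := fun c x z => by
      rw [← formLeft_apply, map_smul]; rfl
    have e3 : ∀ x y z, form z (x - y) = form z x - form z y := fun x y z => by
      rw [form_comm, e1, form_comm x, form_comm y]
    have e4 : ∀ (c : ℝ) x z, form z (c • x) = c * form z x := fun c x z => by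
      rw [form_comm, e2, form_comm x]
    have hpres : ∀ x y, form (x - (2 * form x u) • u) (y - (2 * form y u) • u) = form x y :=
      fun x y => by
        simp only [e1, e2, e3, e4, hu, form_comm u]; ring
    have hfwd : ∀ x, x ∈ cone → x - (2 * form x u) • u ∈ cone := fun x hx => by
      refine mem_cone_of_form_neg hx (by rw [hpres]; exact hx.1) ?_
      rw [e3, e4]
      nlinarith [hx.1, sq_nonneg (form x u)]
    refine ⟨fun x y => by rw [happ, happ, hpres], fun x => ⟨fun h => ?_, fun h => ?_⟩⟩
    · have h2 := hfwd _ h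
      rw [← happ, Module.involutive_reflection] at h2
      exact h2
    · rw [happ]; exact hfwd x h⟩

/-- A compact tetrahedron in the Klein model, with its vertices and the inward unit normals of its
faces: `normal i` belongs to the face opposite to `vert i`. The normals are determined by the
vertices, and the conditions force the vertices to be affinely independent. -/
structure Tetrahedron where
  vert : Fin 4 → Klein
  normal : Fin 4 → Mink
  normal_unit : ∀ i, form (normal i) (normal i) = 1
  normal_face : ∀ i j, j ≠ i → form (vert j).toMink (normal i) = 0
  normal_inward : ∀ i, 0 < form (vert i).toMink (normal i)

namespace Tetrahedron

variable (T : Tetrahedron)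

/-- The closed tetrahedron as a subset of `ℝ³`. -/
def carrier : Set E3 := convexHull ℝ (Set.range fun i => (T.vert i).val)

/-- The interior dihedral angle between the faces opposite to the vertices `i ≠ k`. -/
def dihedralAngle (i k : Fin 4) : ℝ := Real.arccos (-form (T.normal i) (T.normal k))

/-- `T` is a tetrahedron `T(a₁,a₂,a₃;b₁,b₂,b₃)` with distinguished vertex `v = vert 3`. The angles
at the edges not adjacent to `v`, which are those of the face opposite to `v`, are `π/aᵢ`, and the
angles at the edges adjacent to `v` are `π/bᵢ`, the edge labelled `bᵢ` being opposite to the edge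
labelled `aᵢ`. -/
def HasType (a₁ a₂ a₃ b₁ b₂ b₃ : ℕ) : Prop :=
  T.dihedralAngle 0 3 = Real.pi / a₁ ∧ T.dihedralAngle 1 3 = Real.pi / a₂ ∧
  T.dihedralAngle 2 3 = Real.pi / a₃ ∧ T.dihedralAngle 1 2 = Real.pi / b₁ ∧
  T.dihedralAngle 0 2 = Real.pi / b₂ ∧ T.dihedralAngle 0 1 = Real.pi / b₃

/-- The reflection in the face opposite to vertex `i`. -/
def refl (i : Fin 4) : Isom := reflection (T.normal i) (T.normal_unit i)

/-- The group generated by the reflections in the four faces. -/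
def reflectionGroup : Subgroup Isom := Subgroup.closure (Set.range T.refl)

/-- The rotation group: the orientation preserving elements of the reflection group. -/
def rotationGroup : Subgroup Isom := T.reflectionGroup ⊓ SIsom

end Tetrahedron

/-- The quotient `M_Γ = Γ \ ℍ³`. -/
abbrev Orbifold (Γ : Subgroup Isom) : Type := MulAction.orbitRel.Quotient Γ Klein

namespace Orbifold

/-- The quotient map `ℍ³ → M_Γ`. -/
def proj (Γ : Subgroup Isom) (x : Klein) : Orbifold Γ := Quotient.mk _ x

/-- The quotient distance: the distance between two orbits. -/
def dist {Γ : Subgroup Isom} (p q : Orbifold Γ) : ℝ :=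
  sInf {r | ∃ x y : Klein, proj Γ x = p ∧ proj Γ y = q ∧ r = x.dist y}

end Orbifold

/-- A continuous map of orbifolds `M_Γ → M_Γ'`, given by a homomorphism `Γ → Γ'` and an equivariant
continuous lift `ℍ³ → ℍ³`. -/
structure OrbifoldMap (Γ Γ' : Subgroup Isom) where
  lift : Klein → Klein
  hom : Γ →* Γ'
  continuous_lift : Continuous lift
  equivariant : ∀ (g : Γ) (x : Klein), lift (g • x) = hom g • lift x

namespace OrbifoldMap

variable {Γ Γ' : Subgroup Isom} (f : OrbifoldMap Γ Γ')

/-- The underlying map `M_Γ → M_Γ'` of quotient spaces. -/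
def map : Orbifold Γ → Orbifold Γ' :=
  Quotient.lift (fun x => Orbifold.proj Γ' (f.lift x)) (by
    rintro x y ⟨g, rfl⟩
    exact Quotient.sound ⟨f.hom g, (f.equivariant g y).symm⟩)

lemma map_proj (x : Klein) : f.map (Orbifold.proj Γ x) = Orbifold.proj Γ' (f.lift x) := rfl

open Classical in
/-- The lift in the coordinates of the ball, extended by `0` to all of `ℝ³`. -/
def coordLift (x : E3) : E3 := if hx : ‖x‖ < 1 then (f.lift (Klein.mk x hx)).val else 0

/-- The Jacobian determinant of the lift at a point, in the coordinates of the ball. -/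
def jacobian (x : Klein) : ℝ := (fderiv ℝ f.coordLift x.val).det

/-- `f` has degree `n`, for a Lipschitz map `f` between closed orbifolds that are quotients by
rotation groups (orientation preserving groups): almost every point `p` of the target is a regular
value (its preimage is finite, and at each point of it the lift is differentiable with nonzero
Jacobian), and the number of preimages of `p`, counted with the sign of the Jacobian, is `n`. The
sign does not depend on the representative `q.out` of `q` because the groups preserve the
orientation. Null sets for the hyperbolic volume are those for Lebesgue measure on the ball. -/
def HasDegree (n : ℤ) : Prop :=
  ∀ᵐ y : E3, ∀ hy : ‖y‖ < 1,
    {q | f.map q = Orbifold.proj Γ' (Klein.mk y hy)}.Finite ∧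
    (∀ x : Klein, f.map (Orbifold.proj Γ x) = Orbifold.proj Γ' (Klein.mk y hy) →
      DifferentiableAt ℝ f.coordLift x.val ∧ f.jacobian x ≠ 0) ∧
    ∑ᶠ q ∈ {q | f.map q = Orbifold.proj Γ' (Klein.mk y hy)},
      (SignType.sign (f.jacobian q.out) : ℤ) = n

end OrbifoldMap

/-- `T` and `T'` share the vertex `v = vert 3`, placed at the centre of the ball, and the three
faces adjacent to it lie in the same planes, on the same sides. -/
def Tetrahedron.SharesCorner (T T' : Tetrahedron) : Prop :=
  (T.vert 3).val = 0 ∧ (T'.vert 3).val = 0 ∧ ∀ i, i ≠ 3 → T.normal i = T'.normal i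

end Agol

end

/-!
The tetrahedra are Coxeter tetrahedra. By Tits' lemma (`isPositive_of_not_isRightDescent`) the
group generated by the reflections in the faces of such a tetrahedron `T` is the abstract Coxeter
group of its dihedral angles, the cone over `T` is a strict fundamental domain, and the stabilizer
of a point of `T` is generated by the reflections in the faces through the point
(`apply_eq_and_mem_closure`). A volume argument in Minkowski space shows that an orbit has only
finitely many points at bounded distance (`finite_setOf_form_le`); hence the translates of `T`
cover hyperbolic space (`exists_smul_mem_chamber`) and form a locally finite tessellation
(`eventually_mem_chamber`).

The Coxeter relations of `T(2,3,4;2,3,5)` hold between the reflections of `T(2,3,2;2,3,5)`, because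
`2` divides `4`. So a linear map `h` that sends the vertices of the first tetrahedron to those of
the second one, and therefore faces to faces, extends to an equivariant self-map of hyperbolic space
(`Contraction.extend`), which is well defined by the description of the stabilizers.

The metric estimate rests on a property of the Klein model: a linear map of Euclidean operator norm
at most `k < 1` is `k`-Lipschitz for the hyperbolic metric (`Klein.dist_le_of_norm_le`). For the
homothety of ratio `k` the extremal case is a pair of antipodal points, where the claim is the
inequality `k tanh u ≤ tanh (k u)`; the defect of a general linear map from this homothety is a
positive semidefinite matrix, which only decreases the distance. The extension is locally
`k`-Lipschitz by local finiteness, and globally so because straight segments are geodesics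
(`Klein.dist_le_of_eventually`).

The degree is one because a generic point of the target has, up to the rotation group, one preimage,
and the Jacobian of the extension is positive in the interior of each chamber: a projective
transformation `A` has a Jacobian with the sign of `det A`, and the two isometries by which `h` is
conjugated are products of equally many reflections (`Contraction.jacobian_pos`).

It remains to see that `h` has norm at most `0.977`. The three faces at the common vertex have a
Gram matrix over `ℚ(φ)`, with `φ` the golden ratio, and `h` scales the three edges of this corner.
The lengths of the edges are explicit in terms of `φ` and of the cosine of the remaining angle, and
the norm bound is the positive semidefiniteness of an explicit `3 × 3` matrix (`cornerInv_form_le`).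
The same formulas give the existence of both tetrahedra (`exists_tetrahedron`).
-/

noncomputable section

namespace Agol

/-! ### The Minkowski form and the hyperbolic distance -/

lemma form_add_left (x y z : Mink) : form (x + y) z = form x z + form y z :=
  map_add (formLeft z) x y

lemma form_sub_left (x y z : Mink) : form (x - y) z = form x z - form y z :=
  map_sub (formLeft z) x y

lemma form_smul_left (c : ℝ) (x z : Mink) : form (c • x) z = c * form x z :=
  map_smul (formLeft z) c x

lemma form_add_right (x y z : Mink) : form x (y + z) = form x y + form x z := by
  rw [form_comm, form_add_left, form_comm y, form_comm z]

lemma form_smul_right (c : ℝ) (x y : Mink) : form x (c • y) = c * form x y := by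
  rw [form_comm, form_smul_left, form_comm]

lemma form_zero_left (x : Mink) : form 0 x = 0 := map_zero (formLeft x)

lemma continuous_form : Continuous fun p : Mink × Mink => form p.1 p.2 := by
  unfold form
  fun_prop

lemma isOpen_cone : IsOpen cone :=
  (isOpen_lt (continuous_form.comp (continuous_id.prodMk continuous_id)) continuous_const).inter
    (isOpen_lt continuous_const continuous_snd)

lemma smul_mem_cone {c : ℝ} (hc : 0 < c) {x : Mink} (hx : x ∈ cone) : c • x ∈ cone := by
  refine ⟨?_, by simpa using mul_pos hc hx.2⟩
  rw [form_smul_left, form_smul_right]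
  have := hx.1
  have h2 : 0 < c * c := by positivity
  nlinarith

lemma form_neg_of_mem_cone {x y : Mink} (hx : x ∈ cone) (hy : y ∈ cone) : form x y < 0 := by
  rw [cone_iff] at hx hy
  have h := real_inner_le_norm x.1 y.1
  have h2 : ‖x.1‖ * ‖y.1‖ < x.2 * y.2 :=
    mul_lt_mul'' hx hy (norm_nonneg _) (norm_nonneg _)
  unfold form
  linarith

/-- The reversed Cauchy–Schwarz inequality for timelike vectors. -/
lemma form_mul_form_le {x y : Mink} (hx : x ∈ cone) (hy : y ∈ cone) :
    form x x * form y y ≤ form x y ^ 2 := by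
  rw [cone_iff] at hx hy
  have h := real_inner_le_norm x.1 y.1
  have h2 : ‖x.1‖ * ‖y.1‖ < x.2 * y.2 :=
    mul_lt_mul'' hx hy (norm_nonneg _) (norm_nonneg _)
  simp only [form, real_inner_self_eq_norm_sq]
  nlinarith [sq_nonneg (x.2 * ‖y.1‖ - y.2 * ‖x.1‖)]

/-- The form is positive semidefinite on the orthogonal complement of a timelike vector. -/
lemma form_self_nonneg_of_orthogonal {y v : Mink} (hy : y ∈ cone) (h : form v y = 0) :
    0 ≤ form v v := by
  rw [cone_iff] at hy
  simp only [form, real_inner_self_eq_norm_sq] at h ⊢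
  have h1 := abs_real_inner_le_norm v.1 y.1
  rw [sub_eq_zero.1 h, abs_mul] at h1
  have h2 : |v.2| ≤ ‖v.1‖ := by
    have hp : 0 < |y.2| := abs_pos.2 (by linarith [norm_nonneg y.1])
    have h3 : ‖v.1‖ * ‖y.1‖ ≤ ‖v.1‖ * |y.2| :=
      mul_le_mul_of_nonneg_left (hy.le.trans (le_abs_self _)) (norm_nonneg _)
    exact le_of_mul_le_mul_right (h1.trans h3) hp
  nlinarith [abs_nonneg v.2, abs_mul_abs_self v.2, norm_nonneg v.1]

lemma form_sq_le_of_orthogonal {y u v : Mink} (hy : y ∈ cone) (hu : form u y = 0)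
    (hv : form v y = 0) : form u v ^ 2 ≤ form u u * form v v := by
  have key : ∀ t : ℝ, 0 ≤ form v v * (t * t) + (2 * form u v) * t + form u u := fun t => by
    have h := form_self_nonneg_of_orthogonal (v := u + t • v) hy
      (by rw [form_add_left, form_smul_left, hu, hv]; ring)
    simp only [form_add_left, form_add_right, form_smul_left, form_smul_right,
      form_comm v u] at h
    linarith
  have h := discrim_le_zero key
  unfold discrim at h
  linarith

lemma isom_form_apply (A : Isom) (x y : Mink) : form (A.1 x) (A.1 y) = form x y := A.2.1 x y

lemma isom_form_apply_left (A : Isom) (x y : Mink) :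
    form (A.1 x) y = form x ((A⁻¹ : Isom).1 y) := by
  rw [← isom_form_apply A x]
  congr 1
  change y = (A.1 * (A.1)⁻¹) y
  rw [mul_inv_cancel]; rfl

lemma isom_apply_mem_cone (A : Isom) {x : Mink} (hx : x ∈ cone) : A.1 x ∈ cone :=
  (A.2.2 x).2 hx

lemma toMink_smul (A : Isom) (x : Klein) :
    (A • x).toMink = (A.1 x.toMink).2⁻¹ • A.1 x.toMink :=
  proj_toMink _ _

lemma isom_apply_snd_pos (A : Isom) (x : Klein) : 0 < (A.1 x.toMink).2 :=
  (isom_apply_mem_cone A x.toMink_mem_cone).2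

namespace Klein

lemma continuous_val : Continuous val := continuous_subtype_val

lemma isInducing_val : Topology.IsInducing val := Topology.IsInducing.subtypeVal

lemma continuous_toMink : Continuous toMink := continuous_val.prodMk continuous_const

lemma one_sub_norm_sq_pos (x : Klein) : 0 < 1 - ‖x.val‖ ^ 2 := by
  nlinarith [x.norm_val_lt, norm_nonneg x.val]

lemma form_toMink_self (x : Klein) : form x.toMink x.toMink = -(1 - ‖x.val‖ ^ 2) := by
  simp only [form, toMink, real_inner_self_eq_norm_sq]; ring

/-- The point of the hyperboloid `form u u = -1` above a point of the Klein model. -/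
def unit (x : Klein) : Mink := (√(1 - ‖x.val‖ ^ 2))⁻¹ • x.toMink

lemma unit_mem_cone (x : Klein) : x.unit ∈ cone :=
  smul_mem_cone (inv_pos.2 (Real.sqrt_pos.2 x.one_sub_norm_sq_pos)) x.toMink_mem_cone

lemma form_unit_self (x : Klein) : form x.unit x.unit = -1 := by
  have h := x.one_sub_norm_sq_pos
  have h2 := Real.sq_sqrt h.le
  have h3 := Real.sqrt_pos.2 h
  rw [unit, form_smul_left, form_smul_right, form_toMink_self]
  nth_rw 3 [← h2]
  field_simp

lemma neg_form_unit (x y : Klein) : -form x.unit y.unit =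
    (1 - ⟪x.val, y.val⟫) / √((1 - ‖x.val‖ ^ 2) * (1 - ‖y.val‖ ^ 2)) := by
  have h1 := x.one_sub_norm_sq_pos
  have h2 := y.one_sub_norm_sq_pos
  rw [unit, unit, form_smul_left, form_smul_right, Real.sqrt_mul h1.le]
  have h3 := Real.sqrt_pos.2 h1
  have h4 := Real.sqrt_pos.2 h2
  simp only [form, toMink]
  field_simp
  ring

lemma dist_eq (x y : Klein) : x.dist y = Real.arcosh (-form x.unit y.unit) := by
  rw [dist, neg_form_unit]

lemma one_le_neg_form_unit (x y : Klein) : 1 ≤ -form x.unit y.unit := by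
  have h := form_mul_form_le x.unit_mem_cone y.unit_mem_cone
  have h2 := form_neg_of_mem_cone x.unit_mem_cone y.unit_mem_cone
  rw [form_unit_self, form_unit_self] at h
  nlinarith

lemma cosh_dist (x y : Klein) : Real.cosh (x.dist y) = -form x.unit y.unit := by
  rw [dist_eq, Real.cosh_arcosh (one_le_neg_form_unit x y)]

lemma dist_nonneg (x y : Klein) : 0 ≤ x.dist y := by
  rw [dist_eq]; exact Real.arcosh_nonneg (one_le_neg_form_unit x y)

lemma dist_comm (x y : Klein) : x.dist y = y.dist x := by
  rw [dist_eq, dist_eq, form_comm]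

lemma dist_self (x : Klein) : x.dist x = 0 := by
  rw [dist_eq, form_unit_self, neg_neg, Real.arcosh_zero]

lemma sinh_sq_dist (x y : Klein) :
    Real.sinh (x.dist y) ^ 2 = form x.unit y.unit ^ 2 - 1 := by
  rw [Real.sinh_sq, cosh_dist]; ring

lemma dist_le_of_cosh_le {x y : Klein} {r : ℝ} (hr : 0 ≤ r)
    (h : Real.cosh (x.dist y) ≤ Real.cosh r) : x.dist y ≤ r := by
  rw [Real.cosh_le_cosh, abs_of_nonneg (dist_nonneg x y), abs_of_nonneg hr] at h
  exact h

/-- Hyperbolic isometries act linearly on the points of the hyperboloid. -/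
lemma unit_smul (A : Isom) (x : Klein) : (A • x).unit = A.1 x.unit := by
  have hp := isom_apply_snd_pos A x
  have h1 := (A • x).one_sub_norm_sq_pos
  have h : 1 - ‖(A • x).val‖ ^ 2 = (A.1 x.toMink).2⁻¹ ^ 2 * (1 - ‖x.val‖ ^ 2) := by
    have h2 := form_toMink_self (A • x)
    rw [toMink_smul, form_smul_left, form_smul_right, isom_form_apply A, form_toMink_self] at h2
    linarith
  rw [unit, unit, h, toMink_smul, map_smul, smul_smul, Real.sqrt_mul (by positivity),
    Real.sqrt_sq (by positivity)]
  congr 1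
  field_simp

lemma dist_smul (A : Isom) (x y : Klein) : (A • x).dist (A • y) = x.dist y := by
  rw [dist_eq, dist_eq, unit_smul, unit_smul, isom_form_apply A]

/-- The component of `x.unit` orthogonal to `y.unit`. -/
def normalPart (x y : Klein) : Mink := x.unit + form x.unit y.unit • y.unit

lemma form_normalPart_unit (x y : Klein) : form (x.normalPart y) y.unit = 0 := by
  rw [normalPart, form_add_left, form_smul_left, form_unit_self]; ring

lemma form_normalPart_normalPart (x y z : Klein) :
    form (x.normalPart y) (z.normalPart y) =
      form x.unit z.unit + form x.unit y.unit * form y.unit z.unit := by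
  rw [normalPart, normalPart]
  simp only [form_add_left, form_add_right, form_smul_left, form_smul_right, form_unit_self,
    form_comm z.unit y.unit]
  ring

lemma form_normalPart_self (x y : Klein) :
    form (x.normalPart y) (x.normalPart y) = Real.sinh (x.dist y) ^ 2 := by
  rw [form_normalPart_normalPart, form_unit_self, sinh_sq_dist, form_comm y.unit]; ring

/-- The hyperbolic law of cosines. -/
lemma cosh_dist_eq (x y z : Klein) :
    Real.cosh (x.dist z) = Real.cosh (x.dist y) * Real.cosh (y.dist z) -
      form (x.normalPart y) (z.normalPart y) := by
  rw [form_normalPart_normalPart, cosh_dist, cosh_dist, cosh_dist]; ring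

/-- The triangle inequality: in the hyperbolic law of cosines `cosh_dist_eq`, the last term is
bounded by the Cauchy–Schwarz inequality on the complement of `y`. -/
theorem dist_triangle (x y z : Klein) : x.dist z ≤ x.dist y + y.dist z := by
  apply dist_le_of_cosh_le (add_nonneg (dist_nonneg _ _) (dist_nonneg _ _))
  rw [Real.cosh_add, cosh_dist_eq x y z]
  have h := form_sq_le_of_orthogonal y.unit_mem_cone (form_normalPart_unit x y)
    (form_normalPart_unit z y)
  rw [form_normalPart_self, form_normalPart_self, dist_comm z y, ← mul_pow] at h
  have h2 := abs_le_of_sq_le_sq' h (mul_nonneg (Real.sinh_nonneg_iff.2 (dist_nonneg _ _))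
    (Real.sinh_nonneg_iff.2 (dist_nonneg _ _)))
  linarith [h2.1]

/-- Euclidean segments are geodesics of the Klein model. The components of `x` and `z` orthogonal to
`y` are antiparallel, which is the equality case in the proof of the triangle inequality. -/
theorem dist_add_dist_of_segment {x y z : Klein} {s : ℝ} (h0 : 0 ≤ s) (h1 : s ≤ 1)
    (h : y.val = (1 - s) • x.val + s • z.val) : x.dist y + y.dist z = x.dist z := by
  rcases h1.eq_or_lt with rfl | h1
  · have : y = z := by ext1; simpa using h
    rw [this, dist_self, add_zero]
  have hY : y.toMink = (1 - s) • x.toMink + s • z.toMink := by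
    ext1
    · exact h
    · simp [toMink]
  have hx := Real.sqrt_pos.2 x.one_sub_norm_sq_pos
  have hy := Real.sqrt_pos.2 y.one_sub_norm_sq_pos
  have hz := Real.sqrt_pos.2 z.one_sub_norm_sq_pos
  have e : ∀ w : Klein, w.toMink = √(1 - ‖w.val‖ ^ 2) • w.unit := fun w => by
    rw [unit, smul_smul, mul_inv_cancel₀ (Real.sqrt_pos.2 w.one_sub_norm_sq_pos).ne', one_smul]
  rw [e x, e y, e z] at hY
  set a := √(1 - ‖x.val‖ ^ 2)
  set b := √(1 - ‖y.val‖ ^ 2)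
  set c := √(1 - ‖z.val‖ ^ 2)
  -- pairing the relation with the two components orthogonal to `y.unit`
  have hu : ∀ w : Klein, (1 - s) * a * form (x.normalPart y) (w.normalPart y) +
      s * c * form (z.normalPart y) (w.normalPart y) = 0 := fun w => by
    have h2 := congrArg (fun v => form v (w.normalPart y)) hY
    simp only [form_add_left, form_smul_left] at h2
    rw [form_comm y.unit, form_normalPart_unit] at h2
    have h3 : ∀ v : Klein, form (v.normalPart y) (w.normalPart y) =
        form v.unit (w.normalPart y) := fun v => by
      rw [normalPart, form_add_left, form_smul_left, form_comm y.unit, form_normalPart_unit]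
      ring
    rw [h3, h3]
    linarith
  have h2 := hu x
  have h3 := hu z
  rw [form_normalPart_self] at h2 h3
  rw [form_comm (z.normalPart y)] at h2
  set f := form (x.normalPart y) (z.normalPart y) with hf
  have hp : 0 < (1 - s) * a := mul_pos (by linarith) hx
  have hq : 0 ≤ s * c := mul_nonneg h0 hz.le
  have hS := Real.sinh_nonneg_iff.2 (dist_nonneg x y)
  have hS' := Real.sinh_nonneg_iff.2 (dist_nonneg y z)
  rw [dist_comm z y] at h3
  have hfle : f ≤ 0 := by
    by_contra hn
    nlinarith [mul_pos hp (not_le.1 hn), mul_nonneg hq (sq_nonneg (Real.sinh (y.dist z)))]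
  have hff : f ^ 2 = (Real.sinh (x.dist y) * Real.sinh (y.dist z)) ^ 2 := by
    have : ((1 - s) * a) * (f ^ 2 - (Real.sinh (x.dist y) * Real.sinh (y.dist z)) ^ 2) = 0 := by
      linear_combination f * h3 - Real.sinh (y.dist z) ^ 2 * h2
    rcases mul_eq_zero.1 this with h | h
    · exact absurd h hp.ne'
    · linarith
  have hfe : -f = Real.sinh (x.dist y) * Real.sinh (y.dist z) :=
    (pow_left_inj₀ (by linarith) (mul_nonneg hS hS') two_ne_zero).1 (by rw [neg_sq, hff])
  have hc := cosh_dist_eq x y z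
  rw [← hf, sub_eq_add_neg, hfe, ← Real.cosh_add] at hc
  exact Real.cosh_injOn.eq_iff (add_nonneg (dist_nonneg _ _) (dist_nonneg _ _))
    (dist_nonneg _ _) |>.1 hc.symm

lemma continuous_unit : Continuous unit := by
  unfold unit
  refine Continuous.smul (Continuous.inv₀ (Real.continuous_sqrt.comp
    (continuous_const.sub (continuous_val.norm.pow 2))) fun x => ?_) continuous_toMink
  exact (Real.sqrt_pos.2 x.one_sub_norm_sq_pos).ne'

lemma continuous_dist {X : Type*} [TopologicalSpace X] {f g : X → Klein}
    (hf : Continuous f) (hg : Continuous g) : Continuous fun a => (f a).dist (g a) := by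
  simp only [dist_eq]
  refine Real.continuousOn_arcosh.comp_continuous ?_ fun p => one_le_neg_form_unit _ _
  exact (continuous_form.comp ((continuous_unit.comp hf).prodMk (continuous_unit.comp hg))).neg

/-- The Euclidean distance is controlled by the hyperbolic one. -/
lemma norm_sub_le_sinh_dist (x y : Klein) : ‖x.val - y.val‖ ≤ Real.sinh (x.dist y) := by
  refine le_of_sq_le_sq ?_ (Real.sinh_nonneg_iff.2 (dist_nonneg x y))
  have hx := x.one_sub_norm_sq_pos
  have hy := y.one_sub_norm_sq_pos
  have hs : Real.sinh (x.dist y) ^ 2 =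
      ((1 - ⟪x.val, y.val⟫) ^ 2 - (1 - ‖x.val‖ ^ 2) * (1 - ‖y.val‖ ^ 2)) /
        ((1 - ‖x.val‖ ^ 2) * (1 - ‖y.val‖ ^ 2)) := by
    rw [sinh_sq_dist, unit, unit, form_smul_left, form_smul_right, mul_pow, mul_pow, inv_pow,
      inv_pow, Real.sq_sqrt hx.le, Real.sq_sqrt hy.le]
    simp only [form, toMink]
    field_simp
    ring
  rw [hs, le_div_iff₀ (mul_pos hx hy)]
  -- the Cauchy–Schwarz inequality for `x` and `y - x`
  have hcs := abs_real_inner_le_norm x.val (y.val - x.val)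
  have hn : ‖y.val - x.val‖ = ‖x.val - y.val‖ := norm_sub_rev _ _
  rw [hn, inner_sub_right, real_inner_self_eq_norm_sq] at hcs
  have hcs2 := sq_le_sq' (neg_le_of_abs_le hcs) (le_of_abs_le hcs)
  have hd := norm_sub_sq_real x.val y.val
  have h1 : ‖x.val - y.val‖ ^ 2 * ((1 - ‖x.val‖ ^ 2) * (1 - ‖y.val‖ ^ 2)) ≤
      ‖x.val - y.val‖ ^ 2 * (1 - ‖x.val‖ ^ 2) := by
    refine mul_le_mul_of_nonneg_left ?_ (sq_nonneg _)
    nlinarith [sq_nonneg ‖y.val‖]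
  nlinarith

end Klein

/-! ### Linear contractions of the ball -/

/-- The inequality `k tanh u ≤ tanh (k u)` for `0 ≤ k ≤ 1`, cleared of denominators. -/
lemma mul_sinh_mul_cosh_le {k u : ℝ} (hk : 0 ≤ k) (hk1 : k ≤ 1) (hu : 0 ≤ u) :
    k * Real.sinh u * Real.cosh (k * u) ≤ Real.sinh (k * u) * Real.cosh u := by
  let F : ℝ → ℝ := fun u =>
    Real.sinh (k * u) * Real.cosh u - k * Real.sinh u * Real.cosh (k * u)
  have hd : ∀ u, HasDerivAt F ((1 - k ^ 2) * (Real.sinh (k * u) * Real.sinh u)) u := fun u => by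
    have h1 : HasDerivAt (fun u => k * u) k u := by simpa using (hasDerivAt_id u).const_mul k
    have h := (h1.sinh.mul (Real.hasDerivAt_cosh u)).sub
      (((Real.hasDerivAt_sinh u).const_mul k).mul h1.cosh)
    exact h.congr_deriv (by ring)
  have hm : MonotoneOn F (Set.Ici 0) := by
    refine monotoneOn_of_deriv_nonneg (convex_Ici 0)
      (fun u _ => (hd u).continuousAt.continuousWithinAt)
      (fun u _ => (hd u).differentiableAt.differentiableWithinAt) fun u hu => ?_
    rw [interior_Ici] at hu
    have hu : 0 < u := hu
    rw [(hd u).deriv]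
    refine mul_nonneg (by nlinarith) (mul_nonneg ?_ ?_) <;>
      exact Real.sinh_nonneg_iff.2 (by positivity)
  have h := hm (Set.mem_Ici.2 le_rfl) (Set.mem_Ici.2 hu) hu
  simp only [F, mul_zero, Real.sinh_zero, zero_mul, sub_zero] at h
  linarith

/-- With `d = 2 u`, a reformulation of `k tanh u ≤ tanh (k u)`, since
`tanh u ^ 2 = (cosh d - 1) / (cosh d + 1)`. -/
lemma le_cosh_mul {k d : ℝ} (hk : 0 ≤ k) (hk1 : k < 1) (hd : 0 ≤ d) :
    ((1 + k ^ 2) * Real.cosh d + (1 - k ^ 2)) / ((1 - k ^ 2) * Real.cosh d + (1 + k ^ 2)) ≤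
      Real.cosh (k * d) := by
  have h1 := Real.one_le_cosh d
  have hk2 : k ^ 2 < 1 := by nlinarith
  rw [div_le_iff₀ (by nlinarith)]
  obtain ⟨u, rfl⟩ : ∃ u, d = 2 * u := ⟨d / 2, by ring⟩
  have h := mul_sinh_mul_cosh_le hk hk1.le (by linarith : 0 ≤ u)
  rw [show k * (2 * u) = 2 * (k * u) by ring, Real.cosh_two_mul, Real.cosh_two_mul]
  have e1 := Real.cosh_sq u
  have e2 := Real.cosh_sq (k * u)
  have h0 : 0 ≤ k * Real.sinh u * Real.cosh (k * u) :=
    mul_nonneg (mul_nonneg hk (Real.sinh_nonneg_iff.2 (by linarith))) (Real.cosh_pos _).le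
  have h2 := pow_le_pow_left₀ h0 h 2
  simp only [mul_pow, e1, e2] at h2 ⊢
  nlinarith

/-- The estimate for `cosh` of the distance between the images of two points. The matrix
`P = [[A, q], [q, B]]` of the products `1 - ⟪x, y⟫` of the two points is replaced by
`k² P + (1 - k²) J + S`, where `J` is the all-ones matrix and `S` is positive semidefinite; `J`
accounts for the homothety of ratio `k` and `S` for the defect from it. -/
lemma ratio_le_of_perturbation {k A B q S₁ S₂ s : ℝ} (hk : 0 ≤ k) (hk1 : k < 1)
    (hA : 0 < A) (hB : 0 < B) (hq : 0 ≤ q) (hAB : A * B ≤ q ^ 2) (hq2 : A * B ≤ (2 - q) ^ 2)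
    (hq3 : q ≤ 2) (hS₁ : 0 ≤ S₁) (hS₂ : 0 ≤ S₂) (hs : s ^ 2 ≤ S₁ * S₂) :
    (k ^ 2 * q + (1 - k ^ 2) + s) /
        √((k ^ 2 * A + (1 - k ^ 2) + S₁) * (k ^ 2 * B + (1 - k ^ 2) + S₂)) ≤
      ((1 + k ^ 2) * (q / √(A * B)) + (1 - k ^ 2)) /
        ((1 - k ^ 2) * (q / √(A * B)) + (1 + k ^ 2)) := by
  have hk2 : 0 < 1 - k ^ 2 := by nlinarith
  obtain ⟨a, ha, rfl⟩ : ∃ a, 0 < a ∧ a ^ 2 = A := ⟨√A, Real.sqrt_pos.2 hA, Real.sq_sqrt hA.le⟩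
  obtain ⟨b, hb, rfl⟩ : ∃ b, 0 < b ∧ b ^ 2 = B := ⟨√B, Real.sqrt_pos.2 hB, Real.sq_sqrt hB.le⟩
  obtain ⟨u, hu, rfl⟩ : ∃ u, 0 ≤ u ∧ u ^ 2 = S₁ := ⟨√S₁, Real.sqrt_nonneg _, Real.sq_sqrt hS₁⟩
  obtain ⟨v, hv, rfl⟩ : ∃ v, 0 ≤ v ∧ v ^ 2 = S₂ := ⟨√S₂, Real.sqrt_nonneg _, Real.sq_sqrt hS₂⟩
  rw [← mul_pow] at hs hAB hq2
  rw [← mul_pow a b]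
  have hpos : 0 < a * b := mul_pos ha hb
  rw [Real.sqrt_sq hpos.le]
  have hsσ : s ≤ u * v := (abs_le_of_sq_le_sq' hs (mul_nonneg hu hv)).2
  have hpq : a * b ≤ q := le_of_sq_le_sq hAB hq
  have hpq2 : a * b ≤ 2 - q := le_of_sq_le_sq hq2 (by linarith)
  set p := a * b with hp
  set σ := u * v with hσ
  have hσ0 : 0 ≤ σ := mul_nonneg hu hv
  -- the Cauchy–Schwarz inequality for the three summands of the diagonal entries
  have hden : k ^ 2 * p + (1 - k ^ 2) + σ ≤
      √((k ^ 2 * a ^ 2 + (1 - k ^ 2) + u ^ 2) * (k ^ 2 * b ^ 2 + (1 - k ^ 2) + v ^ 2)) := by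
    apply Real.le_sqrt_of_sq_le
    rw [hp, hσ]
    nlinarith [mul_nonneg (mul_nonneg (sq_nonneg k) hk2.le) (sq_nonneg (a - b)),
      mul_nonneg (sq_nonneg k) (sq_nonneg (a * v - b * u)),
      mul_nonneg hk2.le (sq_nonneg (u - v))]
  have hd0 : 0 < k ^ 2 * p + (1 - k ^ 2) + σ := by positivity
  have hn0 : 0 ≤ k ^ 2 * q + (1 - k ^ 2) + σ := by positivity
  calc (k ^ 2 * q + (1 - k ^ 2) + s) / _ ≤ (k ^ 2 * q + (1 - k ^ 2) + σ) / _ := by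
        gcongr
    _ ≤ (k ^ 2 * q + (1 - k ^ 2) + σ) / (k ^ 2 * p + (1 - k ^ 2) + σ) := by gcongr
    _ ≤ (k ^ 2 * q + (1 - k ^ 2)) / (k ^ 2 * p + (1 - k ^ 2)) := by
        rw [div_le_div_iff₀ hd0 (by positivity)]
        nlinarith [mul_nonneg hσ0 (mul_nonneg (sq_nonneg k) (sub_nonneg.2 hpq))]
    -- both sides agree when `q + p = 2`, the case of antipodal points
    _ ≤ _ := by
        have e : ((1 + k ^ 2) * (q / p) + (1 - k ^ 2)) / ((1 - k ^ 2) * (q / p) + (1 + k ^ 2)) =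
            ((1 + k ^ 2) * q + (1 - k ^ 2) * p) / ((1 - k ^ 2) * q + (1 + k ^ 2) * p) := by
          field_simp
        have hpos' : 0 < (1 - k ^ 2) * q + (1 + k ^ 2) * p := by positivity
        rw [e, div_le_div_iff₀ (by positivity) hpos']
        nlinarith [mul_nonneg (mul_nonneg (mul_nonneg (sq_nonneg k) hk2.le)
          (sub_nonneg.2 hpq)) (by linarith : (0 : ℝ) ≤ 2 - q - p)]

/-- A linear map of operator norm at most `k < 1` contracts the Klein metric by the factor `k`. -/
theorem Klein.dist_le_of_norm_le {k : ℝ} (hk : 0 ≤ k) (hk1 : k < 1) (h : E3 →ₗ[ℝ] E3)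
    (hh : ∀ v, ‖h v‖ ≤ k * ‖v‖) {x y x' y' : Klein} (hx : x'.val = h x.val)
    (hy : y'.val = h y.val) : x'.dist y' ≤ k * x.dist y := by
  apply dist_le_of_cosh_le (mul_nonneg hk (dist_nonneg x y))
  refine le_trans ?_ (le_cosh_mul hk hk1 (dist_nonneg x y))
  have hcosh : ∀ z w : Klein, Real.cosh (z.dist w) =
      (1 - ⟪z.val, w.val⟫) / √((1 - ‖z.val‖ ^ 2) * (1 - ‖w.val‖ ^ 2)) := fun z w => by
    rw [cosh_dist, neg_form_unit]
  have hsq : ∀ v, ‖h v‖ ^ 2 ≤ k ^ 2 * ‖v‖ ^ 2 := fun v => by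
    rw [← mul_pow]; exact pow_le_pow_left₀ (norm_nonneg _) (hh v) 2
  have hdisc : ∀ t : ℝ, 0 ≤ (k ^ 2 * ‖y.val‖ ^ 2 - ‖h y.val‖ ^ 2) * (t * t) +
      (2 * (k ^ 2 * ⟪x.val, y.val⟫ - ⟪h x.val, h y.val⟫)) * t +
      (k ^ 2 * ‖x.val‖ ^ 2 - ‖h x.val‖ ^ 2) := fun t => by
    have h1 := hsq (x.val + t • y.val)
    rw [map_add, map_smul, norm_add_sq_real, norm_add_sq_real, norm_smul, norm_smul,
      inner_smul_right, inner_smul_right, mul_pow, mul_pow, Real.norm_eq_abs, sq_abs] at h1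
    linarith
  have hs := discrim_le_zero hdisc
  unfold discrim at hs
  have hx1 := x.norm_val_lt
  have hy1 := y.norm_val_lt
  have hi := abs_real_inner_le_norm x.val y.val
  have hxy : ‖x.val‖ * ‖y.val‖ ≤ 1 := mul_le_one₀ hx1.le (norm_nonneg _) hy1.le
  have hi1 := (abs_le.1 hi).1
  have hi2 := (abs_le.1 hi).2
  have key := ratio_le_of_perturbation (q := 1 - ⟪x.val, y.val⟫) hk hk1
    x.one_sub_norm_sq_pos y.one_sub_norm_sq_pos (by linarith)
    (by nlinarith [sq_nonneg (‖x.val‖ - ‖y.val‖)]) (by nlinarith [sq_nonneg (‖x.val‖ - ‖y.val‖)])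
    (by linarith) (sub_nonneg.2 (hsq x.val)) (sub_nonneg.2 (hsq y.val))
    (s := k ^ 2 * ⟪x.val, y.val⟫ - ⟪h x.val, h y.val⟫) (by linarith)
  rw [← hcosh] at key
  rw [hcosh, hx, hy]
  have e1 : k ^ 2 * (1 - ⟪x.val, y.val⟫) + (1 - k ^ 2) +
      (k ^ 2 * ⟪x.val, y.val⟫ - ⟪h x.val, h y.val⟫) = 1 - ⟪h x.val, h y.val⟫ := by ring
  have e2 : ∀ v : E3, k ^ 2 * (1 - ‖v‖ ^ 2) + (1 - k ^ 2) + (k ^ 2 * ‖v‖ ^ 2 - ‖h v‖ ^ 2) =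
      1 - ‖h v‖ ^ 2 := fun v => by ring
  rwa [e1, e2, e2] at key

/-! ### The reflection group as a Coxeter group -/

namespace Tetrahedron

open CoxeterSystem

lemma refl_apply (T : Tetrahedron) (i : Fin 4) (x : Mink) :
    (T.refl i).1 x = x - (2 * form x (T.normal i)) • T.normal i := by
  simp [refl, reflection, Module.reflection_apply, formLeft_apply]

/-- `T` is a Coxeter tetrahedron with Coxeter matrix `M`: the dihedral angle between the faces
`i` and `j` is `π / M i j`, as expressed by the Gram matrix of the normals. All entries are
required to be finite, which `CoxeterMatrix` encodes by being nonzero. -/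
def IsCoxeter (T : Tetrahedron) (M : CoxeterMatrix (Fin 4)) : Prop :=
  ∀ i j, M i j ≠ 0 ∧ form (T.normal i) (T.normal j) = -Real.cos (Real.pi / M i j)

variable {T : Tetrahedron} {M : CoxeterMatrix (Fin 4)}

lemma refl_mul_refl_apply (T : Tetrahedron) (i j : Fin 4) (x : Mink) :
    (T.refl i * T.refl j).1 x = (T.refl i).1 ((T.refl j).1 x) := rfl

lemma refl_mul_self (T : Tetrahedron) (i : Fin 4) : T.refl i * T.refl i = 1 := by
  apply Subtype.ext
  apply LinearEquiv.ext
  intro x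
  rw [refl_mul_refl_apply, refl_apply, refl_apply, form_sub_left, form_smul_left, T.normal_unit]
  change _ = x
  module

/-- The product of the reflections in two faces that meet at the angle `θ` rotates the plane spanned
by their normals by the angle `2θ`. -/
lemma refl_mul_refl_pow_apply_normal {i j : Fin 4} {θ : ℝ}
    (h : form (T.normal i) (T.normal j) = -Real.cos θ) (k : ℕ) :
    Real.sin θ • ((T.refl i * T.refl j) ^ k).1 (T.normal i) =
        Real.sin ((2 * k + 1) * θ) • T.normal i + Real.sin (2 * k * θ) • T.normal j ∧
      Real.sin θ • ((T.refl i * T.refl j) ^ k).1 (T.normal j) =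
        -Real.sin (2 * k * θ) • T.normal i - Real.sin ((2 * k - 1) * θ) • T.normal j := by
  induction k with
  | zero =>
    have e : ((T.refl i * T.refl j) ^ 0).1 = LinearEquiv.refl ℝ Mink := rfl
    rw [e]
    constructor <;> simp
  | succ k ih =>
    have e : ∀ x, ((T.refl i * T.refl j) ^ (k + 1)).1 x =
        (T.refl i).1 ((T.refl j).1 (((T.refl i * T.refl j) ^ k).1 x)) := fun x => by
      rw [pow_succ']; rfl
    have h2 : form (T.normal j) (T.normal i) = -Real.cos θ := by rw [form_comm, h]
    have hab : ∀ a b : ℝ, (T.refl i).1 ((T.refl j).1 (a • T.normal i + b • T.normal j)) =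
        ((4 * Real.cos θ ^ 2 - 1) * a - 2 * Real.cos θ * b) • T.normal i +
          (2 * Real.cos θ * a - b) • T.normal j := fun a b => by
      simp only [refl_apply, form_add_left, form_sub_left, form_smul_left, T.normal_unit, h, h2]
      module
    have s1 : ∀ a, Real.sin (a + θ) = 2 * Real.cos θ * Real.sin a - Real.sin (a - θ) := fun a => by
      rw [Real.sin_add, Real.sin_sub]; ring
    have hmul : ∀ (c : ℝ) (x : Mink), c • (T.refl i).1 ((T.refl j).1 x) =
        (T.refl i).1 ((T.refl j).1 (c • x)) := fun c x => by rw [map_smul, map_smul]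
    rw [e, e, hmul, hmul, ih.1, ih.2, hab,
      sub_eq_add_neg (-Real.sin (2 * k * θ) • T.normal i), ← neg_smul, hab]
    push_cast
    have a1 := s1 ((2 * k + 1) * θ)
    have a2 := s1 ((2 * k + 2) * θ)
    have a3 := s1 (2 * k * θ)
    rw [show (2 * k + 1) * θ + θ = 2 * (k + 1) * θ by ring,
      show (2 * k + 1) * θ - θ = 2 * k * θ by ring] at a1
    rw [show (2 * k + 2) * θ + θ = (2 * (k + 1) + 1) * θ by ring,
      show (2 * k + 2) * θ - θ = (2 * k + 1) * θ by ring,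
      show (2 * k + 2) * θ = 2 * (k + 1) * θ by ring] at a2
    rw [show 2 * k * θ + θ = (2 * k + 1) * θ by ring,
      show 2 * k * θ - θ = (2 * k - 1) * θ by ring] at a3
    rw [show (2 * ((k : ℝ) + 1) - 1) * θ = (2 * k + 1) * θ by ring, a2, a1, a3]
    constructor
    · module
    · module

/-- The Coxeter relations hold: a product of two reflections rotates the span of the two normals
and fixes its orthogonal complement. -/
lemma IsCoxeter.isLiftable (hT : T.IsCoxeter M) : M.IsLiftable T.refl := by
  intro i j
  rcases eq_or_ne i j with rfl | hij
  · rw [M.diagonal, pow_one, refl_mul_self]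
  obtain ⟨h0, h⟩ := hT i j
  have h1 := M.off_diagonal i j hij
  set m := M i j
  have hm : (2 : ℝ) ≤ m := by exact_mod_cast (by omega : 2 ≤ m)
  set θ := Real.pi / m with hθ
  have hmθ : m * θ = Real.pi := by rw [hθ]; field_simp
  have hs : 0 < Real.sin θ := by
    apply Real.sin_pos_of_pos_of_lt_pi (by positivity)
    nlinarith [Real.pi_pos, show 0 < θ by positivity]
  have hs2 := Real.sin_sq θ
  obtain ⟨hi, hj⟩ := refl_mul_refl_pow_apply_normal h m
  rw [show (2 * m + 1) * θ = θ + 2 * Real.pi by linear_combination 2 * hmθ,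
    show 2 * m * θ = 2 * Real.pi by linear_combination 2 * hmθ, Real.sin_add_two_pi,
    Real.sin_two_pi, zero_smul, add_zero] at hi
  rw [show (2 * m - 1) * θ = 2 * Real.pi - θ by linear_combination 2 * hmθ,
    show 2 * m * θ = 2 * Real.pi by linear_combination 2 * hmθ, Real.sin_two_pi_sub,
    Real.sin_two_pi, neg_zero, zero_smul, zero_sub, neg_smul, neg_neg] at hj
  have hi := smul_right_injective Mink hs.ne' hi
  have hj := smul_right_injective Mink hs.ne' hj
  have hperp : ∀ (k : ℕ) (z : Mink), form z (T.normal i) = 0 → form z (T.normal j) = 0 →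
      ((T.refl i * T.refl j) ^ k).1 z = z := fun k z hzi hzj => by
    induction k with
    | zero => rfl
    | succ k ih =>
      have e : ((T.refl i * T.refl j) ^ (k + 1)).1 z =
          (T.refl i).1 ((T.refl j).1 (((T.refl i * T.refl j) ^ k).1 z)) := by
        rw [pow_succ']; rfl
      rw [e, ih, refl_apply, refl_apply, hzj]
      simp [hzi]
  apply Subtype.ext
  apply LinearEquiv.ext
  intro z
  change _ = z
  -- split `z` along the span of the two normals and its orthogonal complement
  set a := (form z (T.normal i) + Real.cos θ * form z (T.normal j)) / Real.sin θ ^ 2 with ha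
  set b := (Real.cos θ * form z (T.normal i) + form z (T.normal j)) / Real.sin θ ^ 2 with hb
  obtain ⟨z', hz'⟩ : ∃ z', z = a • T.normal i + b • T.normal j + z' :=
    ⟨z - (a • T.normal i + b • T.normal j), by abel⟩
  have hz'2 : z' = z - (a • T.normal i + b • T.normal j) := by rw [hz']; abel
  have h2 : form (T.normal j) (T.normal i) = -Real.cos θ := by rw [form_comm, h]
  have p := hperp m z'
    (by
      rw [hz'2, form_sub_left, form_add_left, form_smul_left, form_smul_left, T.normal_unit, h2,
        ha, hb]
      field_simp
      rw [hs2]; ring)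
    (by
      rw [hz'2, form_sub_left, form_add_left, form_smul_left, form_smul_left, T.normal_unit, h,
        ha, hb]
      field_simp
      rw [hs2]; ring)
  clear_value a b
  rw [hz', map_add, map_add, map_smul, map_smul]
  erw [hi, hj, p]

/-- The linear cone over the tetrahedron: the vectors on the inner side of all faces. -/
def innerCone (T : Tetrahedron) : Set Mink := {x | ∀ i, 0 ≤ form x (T.normal i)}

/-- A vector is a positive covector for `T` if it pairs nonnegatively with the cone over `T`.
Nonnegative combinations of the normals have this property. -/
def IsPositive (T : Tetrahedron) (v : Mink) : Prop := ∀ x ∈ T.innerCone, 0 ≤ form x v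

/-- The representation of an abstract Coxeter group that sends its simple reflections to the
reflections in the faces of `T`. The matrix `M` need not be that of `T`: it is enough that the
relations hold. -/
def rep (T : Tetrahedron) (hM : M.IsLiftable T.refl) : M.Group →* Isom :=
  M.toCoxeterSystem.lift ⟨T.refl, hM⟩

lemma rep_simple (hM : M.IsLiftable T.refl) (i : Fin 4) :
    T.rep hM (M.toCoxeterSystem.simple i) = T.refl i :=
  M.toCoxeterSystem.lift_apply_simple hM i

lemma rep_mul_apply (hM : M.IsLiftable T.refl) (v w : M.Group) (x : Mink) :
    (T.rep hM (v * w)).1 x = (T.rep hM v).1 ((T.rep hM w).1 x) := by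
  rw [map_mul]; rfl

lemma rep_one_apply (hM : M.IsLiftable T.refl) (x : Mink) : (T.rep hM 1).1 x = x := by
  rw [map_one]; rfl

/-- The action of alternating words on a simple root in a dihedral group. -/
lemma rep_alternatingWord_apply_normal (hM : M.IsLiftable T.refl) {i j : Fin 4} {θ : ℝ}
    (h : form (T.normal i) (T.normal j) = -Real.cos θ) (k : ℕ) :
    Real.sin θ • (T.rep hM (M.toCoxeterSystem.wordProd (alternatingWord i j k))).1 (T.normal i) =
      Real.sin ((k + 1) * θ) • T.normal (if Even k then i else j) +
        Real.sin (k * θ) • T.normal (if Even k then j else i) := by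
  induction k with
  | zero =>
    simp only [alternatingWord, wordProd_nil, rep_one_apply]
    simp
  | succ k ih =>
    rw [alternatingWord_succ', wordProd_cons, rep_mul_apply, ← map_smul, ih, rep_simple]
    have s1 : Real.sin ((k + 1 + 1) * θ) =
        2 * Real.cos θ * Real.sin ((k + 1) * θ) - Real.sin (k * θ) := by
      rw [show ((k : ℝ) + 1 + 1) * θ = (k + 1) * θ + θ by ring,
        show (k : ℝ) * θ = (k + 1) * θ - θ by ring, Real.sin_add, Real.sin_sub]
      ring
    have h2 : form (T.normal j) (T.normal i) = -Real.cos θ := by rw [form_comm, h]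
    push_cast
    rw [s1]
    by_cases hk : Even k
    · simp only [hk, Nat.even_add_one, if_true, if_false, not_true, refl_apply, form_add_left,
        form_smul_left, T.normal_unit, h]
      module
    · simp only [hk, Nat.even_add_one, if_true, if_false, not_false_iff, refl_apply, form_add_left,
        form_smul_left, T.normal_unit, h2]
      module

/-- Tits' lemma: an element that is not shortened by a simple reflection on the right maps the
corresponding simple root to a positive one. -/
theorem IsCoxeter.isPositive_of_not_isRightDescent (hT : T.IsCoxeter M) {w : M.Group} {i : Fin 4}
    (hw : ¬M.toCoxeterSystem.IsRightDescent w i) :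
    T.IsPositive ((T.rep hT.isLiftable w).1 (T.normal i)) := by
  set cs := M.toCoxeterSystem with hcs
  set ρ := T.rep hT.isLiftable with hρ
  induction hn : cs.length w using Nat.strong_induction_on generalizing w i with
  | _ n IH =>
  subst hn
  by_cases hw1 : w = 1
  · subst hw1
    rw [hρ, rep_one_apply]
    exact fun x hx => hx i
  obtain ⟨j, hj⟩ := cs.exists_rightDescent_of_ne_one hw1
  have hij : i ≠ j := by rintro rfl; exact hw hj
  obtain ⟨hm0, hG⟩ := hT i j
  have hm2 : 2 ≤ M i j := by have := M.off_diagonal i j hij; omega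
  set θ := Real.pi / M i j with hθ
  have hm2' : (2 : ℝ) ≤ M i j := by exact_mod_cast hm2
  have hmθ : M i j * θ = Real.pi := by rw [hθ]; field_simp
  have hθ0 : 0 < θ := by have := Real.pi_pos; positivity
  have hs : 0 < Real.sin θ := Real.sin_pos_of_pos_of_lt_pi hθ0 (by nlinarith)
  rw [cs.not_isRightDescent_iff] at hw
  -- strip letters `j`, `i`, `j`, ... from the right of `w` as long as this shortens the element
  have key : ∀ (N : ℕ) (v : M.Group) (k : ℕ), cs.length v = N →
      w = v * cs.wordProd (alternatingWord i j k) → cs.length w = cs.length v + k → k ≠ 0 →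
      ¬cs.IsRightDescent v (if Even k then i else j) →
      T.IsPositive ((ρ w).1 (T.normal i)) := by
    intro N
    induction N using Nat.strong_induction_on with
    | _ N ihN =>
    intro v k hv hwv hlen hk hnd
    by_cases hd : cs.IsRightDescent v (if Even k then j else i)
    · have hl := cs.isRightDescent_iff.1 hd
      refine ihN _ (by omega) (v * cs.simple (if Even k then j else i)) (k + 1) rfl ?_ ?_
        k.succ_ne_zero ?_
      · rw [alternatingWord_succ', wordProd_cons, ← mul_assoc, simple_mul_simple_cancel_right, hwv]
      · omega
      · have hc : (if Even (k + 1) then i else j) = if Even k then j else i := by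
          by_cases hk : Even k <;> simp [hk, Nat.even_add_one]
        rw [hc]
        exact cs.isRightDescent_iff_not_isRightDescent_mul.1 hd
    -- the stripped word is shorter than the longest element of the dihedral group
    have hkm : k + 1 ≤ M i j := by
      by_contra hcon
      have hnr := cs.not_isReduced_alternatingWord j i (m := k + 1) (by rwa [M.symmetric])
        (by rw [M.symmetric]; omega)
      have hle := cs.length_wordProd_le (alternatingWord j i (k + 1))
      have hne : cs.length (cs.wordProd (alternatingWord j i (k + 1))) ≠ k + 1 := fun h => by
        apply hnr
        rw [CoxeterSystem.IsReduced, h, length_alternatingWord]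
      rw [length_alternatingWord] at hle
      have hws : w * cs.simple i = v * cs.wordProd (alternatingWord j i (k + 1)) := by
        rw [alternatingWord_succ, wordProd_concat, ← mul_assoc, ← hwv]
      have hml := cs.length_mul_le v (cs.wordProd (alternatingWord j i (k + 1)))
      rw [← hws] at hml
      omega
    have hlt : cs.length v < cs.length w := by omega
    have hpos : T.IsPositive ((ρ v).1 (T.normal (if Even k then i else j))) :=
      IH _ hlt hnd rfl
    have hpos' : T.IsPositive ((ρ v).1 (T.normal (if Even k then j else i))) :=
      IH _ hlt hd rfl
    have hkm' : (k : ℝ) + 1 ≤ M i j := by exact_mod_cast hkm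
    have hs1 : 0 ≤ Real.sin ((k + 1) * θ) :=
      Real.sin_nonneg_of_nonneg_of_le_pi (by positivity) (by nlinarith)
    have hs2 : 0 ≤ Real.sin (k * θ) :=
      Real.sin_nonneg_of_nonneg_of_le_pi (by positivity) (by nlinarith)
    intro x hx
    have h1 : Real.sin θ * form x ((ρ w).1 (T.normal i)) =
        Real.sin ((k + 1) * θ) * form x ((ρ v).1 (T.normal (if Even k then i else j))) +
        Real.sin (k * θ) * form x ((ρ v).1 (T.normal (if Even k then j else i))) := by
      rw [hwv, hρ, rep_mul_apply, ← form_smul_right, ← map_smul,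
        rep_alternatingWord_apply_normal hT.isLiftable hG, map_add, map_smul, map_smul,
        form_add_right, form_smul_right, form_smul_right]
    have h2 : 0 ≤ Real.sin θ * form x ((ρ w).1 (T.normal i)) := by
      rw [h1]
      exact add_nonneg (mul_nonneg hs1 (hpos x hx)) (mul_nonneg hs2 (hpos' x hx))
    exact nonneg_of_mul_nonneg_right h2 hs
  refine key _ (w * cs.simple j) 1 rfl ?_ ?_ one_ne_zero ?_
  · simp [alternatingWord]
  · exact (cs.isRightDescent_iff.1 hj).symm
  · simpa using cs.isRightDescent_iff_not_isRightDescent_mul.1 hj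

/-- The cone over a Coxeter tetrahedron is a strict fundamental domain, and stabilisers are
generated by the reflections in the faces that contain the point. -/
theorem IsCoxeter.apply_eq_and_mem_closure (hT : T.IsCoxeter M) {w : M.Group} {x : Mink}
    (hx : x ∈ T.innerCone) (hwx : (T.rep hT.isLiftable w).1 x ∈ T.innerCone) :
    (T.rep hT.isLiftable w).1 x = x ∧
      w ∈ Subgroup.closure (M.toCoxeterSystem.simple '' {i | form x (T.normal i) = 0}) := by
  set cs := M.toCoxeterSystem with hcs
  set ρ := T.rep hT.isLiftable with hρ
  induction hn : cs.length w using Nat.strong_induction_on generalizing w with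
  | _ n IH =>
  subst hn
  by_cases hw1 : w = 1
  · subst hw1
    exact ⟨rep_one_apply _ x, one_mem _⟩
  obtain ⟨i, hi⟩ := cs.exists_leftDescent_of_ne_one hw1
  set v := cs.simple i * w with hv
  have hw : w = cs.simple i * v := by rw [hv, cs.simple_mul_simple_cancel_left]
  have hpos : T.IsPositive ((ρ v⁻¹).1 (T.normal i)) := by
    apply hT.isPositive_of_not_isRightDescent
    rw [← hcs, cs.isRightDescent_inv_iff]
    exact cs.isLeftDescent_iff_not_isLeftDescent_mul.1 hi
  have h1 := hpos x hx
  rw [map_inv, ← isom_form_apply_left] at h1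
  have h2 : (ρ w).1 x = (T.refl i).1 ((ρ v).1 x) := by
    rw [hw, hρ, rep_mul_apply, rep_simple]
  have h3 : form ((ρ v).1 x) (T.normal i) = 0 := by
    have h4 := hwx i
    rw [h2, refl_apply, form_sub_left, form_smul_left, T.normal_unit] at h4
    linarith
  have h4 : (ρ w).1 x = (ρ v).1 x := by
    rw [h2, refl_apply, h3, mul_zero, zero_smul, sub_zero]
  rw [h4] at hwx ⊢
  obtain ⟨h5, h6⟩ := IH _ hi hwx rfl
  refine ⟨h5, ?_⟩
  rw [hw]
  refine mul_mem (Subgroup.subset_closure ⟨i, ?_, rfl⟩) h6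
  rw [h5] at h3
  exact h3

end Tetrahedron

/-! ### Determinants and orientation -/

/-- The determinant of a hyperbolic isometry, as a homomorphism to the units of `ℝ`. -/
def detHom : Isom →* ℝˣ := LinearEquiv.det.comp Isom.subtype

lemma detHom_val (A : Isom) : (detHom A : ℝ) = LinearMap.det (A.1 : Mink →ₗ[ℝ] Mink) :=
  LinearEquiv.coe_det A.1

lemma Klein.continuous_smul (A : Isom) : Continuous fun x : Klein => A • x := by
  rw [isInducing_val.continuous_iff]
  have h : Continuous fun x : Klein => A.1 x.toMink :=
    (A.1 : Mink →ₗ[ℝ] Mink).continuous_of_finiteDimensional.comp continuous_toMink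
  exact (h.snd.inv₀ fun x => (isom_apply_snd_pos A x).ne').smul h.fst

namespace Tetrahedron

open CoxeterSystem

variable {T T' : Tetrahedron} {M : CoxeterMatrix (Fin 4)}

lemma detHom_refl (T : Tetrahedron) (i : Fin 4) : detHom (T.refl i) = -1 := by
  ext
  have e : ((T.refl i).1 : Mink →ₗ[ℝ] Mink) =
      LinearMap.transvection ((-2 : ℝ) • formLeft (T.normal i)) (T.normal i) := by
    apply LinearMap.ext
    intro x
    rw [LinearEquiv.coe_coe, refl_apply, LinearMap.transvection.apply, LinearMap.smul_apply,
      formLeft_apply, smul_eq_mul]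
    module
  rw [detHom_val, e, LinearMap.transvection.det, LinearMap.smul_apply, formLeft_apply,
    T.normal_unit]
  norm_num

/-- The orientation character of a group element does not depend on the tetrahedron. -/
lemma detHom_rep_eq (hM : M.IsLiftable T.refl) (hM' : M.IsLiftable T'.refl) (w : M.Group) :
    detHom (T.rep hM w) = detHom (T'.rep hM' w) := by
  have h : detHom.comp (T.rep hM) = detHom.comp (T'.rep hM') := by
    apply M.toCoxeterSystem.ext_simple
    intro i
    rw [MonoidHom.comp_apply, MonoidHom.comp_apply, rep_simple, rep_simple, detHom_refl,
      detHom_refl]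
  exact DFunLike.congr_fun h w

lemma detHom_rep (hM : M.IsLiftable T.refl) (w : M.Group) :
    detHom (T.rep hM w) = 1 ∨ detHom (T.rep hM w) = -1 := by
  refine M.toCoxeterSystem.simple_induction
    (p := fun w => detHom (T.rep hM w) = 1 ∨ detHom (T.rep hM w) = -1) w (fun i => ?_) ?_
    fun v w hv hw => ?_
  · rw [rep_simple, detHom_refl]; simp
  · simp
  · rw [map_mul, map_mul]
    rcases hv with h | h <;> rcases hw with h' | h' <;> simp [h, h']

/-! ### The tetrahedron as a fundamental chamber -/

/-- The closed tetrahedron in the Klein model, as the intersection of its half-spaces. -/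
def chamber (T : Tetrahedron) : Set Klein := {x | x.toMink ∈ T.innerCone}

/-- The open tetrahedron in the Klein model. -/
def openChamber (T : Tetrahedron) : Set Klein := {x | ∀ i, 0 < form x.toMink (T.normal i)}

lemma openChamber_subset (T : Tetrahedron) : T.openChamber ⊆ T.chamber := fun _ hx i => (hx i).le

lemma smul_mem_chamber_iff (A : Isom) (x : Klein) :
    A • x ∈ T.chamber ↔ A.1 x.toMink ∈ T.innerCone := by
  have hp := isom_apply_snd_pos A x
  refine forall_congr' fun i => ?_
  rw [toMink_smul, form_smul_left, mul_nonneg_iff_of_pos_left (inv_pos.2 hp)]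

lemma smul_mem_openChamber_iff (A : Isom) (x : Klein) :
    A • x ∈ T.openChamber ↔ ∀ i, 0 < form (A.1 x.toMink) (T.normal i) := by
  have hp := isom_apply_snd_pos A x
  refine forall_congr' fun i => ?_
  rw [toMink_smul, form_smul_left, mul_pos_iff_of_pos_left (inv_pos.2 hp)]

lemma isClosed_chamber (T : Tetrahedron) : IsClosed T.chamber := by
  have e : T.chamber = ⋂ i, {x : Klein | 0 ≤ form x.toMink (T.normal i)} := by
    ext x; simp [chamber, innerCone]
  rw [e]
  exact isClosed_iInter fun i => isClosed_le continuous_const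
    (continuous_form.comp (Klein.continuous_toMink.prodMk continuous_const))

lemma isOpen_openChamber (T : Tetrahedron) : IsOpen T.openChamber := by
  have e : T.openChamber = ⋂ i, {x : Klein | 0 < form x.toMink (T.normal i)} := by
    ext x; simp [openChamber]
  rw [e]
  exact isOpen_iInter_of_finite fun i => isOpen_lt continuous_const
    (continuous_form.comp (Klein.continuous_toMink.prodMk continuous_const))

lemma form_sum_smul_vert_normal (T : Tetrahedron) (c : Fin 4 → ℝ) (i : Fin 4) :
    form (∑ j, c j • (T.vert j).toMink) (T.normal i) =
      c i * form (T.vert i).toMink (T.normal i) := by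
  rw [← formLeft_apply, map_sum, Finset.sum_eq_single i]
  · rw [map_smul, formLeft_apply, smul_eq_mul]
  · intro j _ hj
    rw [map_smul, formLeft_apply, T.normal_face i j hj, smul_zero]
  · simp

/-- The vertices, as vectors of Minkowski space, form a basis. -/
def vertBasis (T : Tetrahedron) : Module.Basis (Fin 4) ℝ Mink :=
  basisOfLinearIndependentOfCardEqFinrank (b := fun i => (T.vert i).toMink)
    (by
      rw [Fintype.linearIndependent_iff]
      intro c hc i
      have h := form_sum_smul_vert_normal T c i
      rw [hc, form_zero_left] at h
      exact (mul_eq_zero.1 h.symm).resolve_right (T.normal_inward i).ne')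
    (by simp)

lemma vertBasis_apply (T : Tetrahedron) (i : Fin 4) : T.vertBasis i = (T.vert i).toMink := by
  simp [vertBasis]

lemma form_normal_eq (T : Tetrahedron) (x : Mink) (i : Fin 4) :
    form x (T.normal i) = T.vertBasis.repr x i * form (T.vert i).toMink (T.normal i) := by
  have h := T.vertBasis.sum_repr x
  simp only [vertBasis_apply] at h
  rw [← form_sum_smul_vert_normal, h]

lemma mem_innerCone_of_mem_carrier {x : E3} (hx : x ∈ T.carrier) :
    ((x, 1) : Mink) ∈ T.innerCone := by
  have hc : Convex ℝ {x : E3 | ((x, 1) : Mink) ∈ T.innerCone} := by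
    intro x hx y hy a b ha hb hab i
    have e : ((a • x + b • y, 1) : Mink) = a • ((x, 1) : Mink) + b • ((y, 1) : Mink) := by
      ext1 <;> simp [hab]
    rw [e, form_add_left, form_smul_left, form_smul_left]
    exact add_nonneg (mul_nonneg ha (hx i)) (mul_nonneg hb (hy i))
  refine convexHull_min ?_ hc hx
  rintro _ ⟨j, rfl⟩ i
  change 0 ≤ form (T.vert j).toMink (T.normal i)
  rcases eq_or_ne j i with rfl | hij
  · exact (T.normal_inward j).le
  · exact (T.normal_face i j hij).ge

lemma mem_carrier_of_mem_innerCone {x : E3} (hx : ((x, 1) : Mink) ∈ T.innerCone) :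
    x ∈ T.carrier := by
  set c := fun i => T.vertBasis.repr (x, 1) i with hc
  have hc0 : ∀ i, 0 ≤ c i := fun i => by
    have h := hx i
    rw [form_normal_eq] at h
    exact nonneg_of_mul_nonneg_left h (T.normal_inward i)
  have hsum : ∑ i, c i • (T.vert i).toMink = ((x, 1) : Mink) := by
    simpa [vertBasis_apply] using T.vertBasis.sum_repr (x, 1)
  have h1 := congrArg Prod.fst hsum
  have h2 := congrArg Prod.snd hsum
  rw [Prod.fst_sum] at h1
  rw [Prod.snd_sum] at h2
  simp only [Prod.smul_fst, Prod.smul_snd, Klein.toMink, smul_eq_mul, mul_one] at h1 h2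
  rw [← h1]
  exact (convex_convexHull ℝ _).sum_mem (fun i _ => hc0 i) h2
    fun i _ => subset_convexHull ℝ _ ⟨i, rfl⟩

/-- A compact tetrahedron is contained in a smaller concentric ball. -/
lemma exists_norm_le (T : Tetrahedron) :
    ∃ r < 1, ∀ x : E3, ((x, 1) : Mink) ∈ T.innerCone → ‖x‖ ≤ r := by
  obtain ⟨j, -, hj⟩ := Finset.exists_max_image Finset.univ (fun i => ‖(T.vert i).val‖)
    Finset.univ_nonempty
  refine ⟨‖(T.vert j).val‖, (T.vert j).norm_val_lt, fun x hx => ?_⟩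
  have h : T.carrier ⊆ Metric.closedBall 0 ‖(T.vert j).val‖ := by
    refine convexHull_min ?_ (convex_closedBall _ _)
    rintro _ ⟨i, rfl⟩
    exact mem_closedBall_zero_iff.2 (hj i (Finset.mem_univ i))
  exact mem_closedBall_zero_iff.1 (h (mem_carrier_of_mem_innerCone hx))

/-- The barycentre of the tetrahedron. -/
def center (T : Tetrahedron) : Klein :=
  Klein.mk ((4 : ℝ)⁻¹ • ∑ i, (T.vert i).val) (by
    have h : ‖∑ i, (T.vert i).val‖ < 4 := by
      refine (norm_sum_le _ _).trans_lt ?_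
      calc ∑ i, ‖(T.vert i).val‖ < ∑ _i : Fin 4, (1 : ℝ) :=
            Finset.sum_lt_sum_of_nonempty Finset.univ_nonempty fun i _ => (T.vert i).norm_val_lt
        _ = 4 := by simp
    rw [norm_smul, norm_inv, Real.norm_eq_abs, abs_of_pos (by norm_num : (0 : ℝ) < 4)]
    linarith)

lemma center_mem_openChamber (T : Tetrahedron) : T.center ∈ T.openChamber := by
  intro i
  have e : T.center.toMink = ∑ j, (4 : ℝ)⁻¹ • (T.vert j).toMink := by
    ext1
    · rw [Prod.fst_sum]
      change (4 : ℝ)⁻¹ • ∑ i, (T.vert i).val = _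
      rw [Finset.smul_sum]; rfl
    · rw [Prod.snd_sum]
      simp [Klein.toMink]
  rw [e, form_sum_smul_vert_normal T fun _ => (4 : ℝ)⁻¹]
  have := T.normal_inward i
  positivity

/-- The open chamber is disjoint from its nontrivial translates. -/
lemma IsCoxeter.eq_one_of_mem (hT : T.IsCoxeter M) {w : M.Group} {x : Mink}
    (hx : ∀ i, 0 < form x (T.normal i)) (hwx : (T.rep hT.isLiftable w).1 x ∈ T.innerCone) :
    w = 1 := by
  have h := (hT.apply_eq_and_mem_closure (fun i => (hx i).le) hwx).2
  have he : {i | form x (T.normal i) = 0} = ∅ := by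
    ext i
    simp [(hx i).ne']
  rwa [he, Set.image_empty, Subgroup.closure_empty, Subgroup.mem_bot] at h

/-! ### Discreteness and the tessellation -/

open MeasureTheory in
/-- Discreteness of the reflection group: the translates of a small open set above the open
tetrahedron are disjoint, and they all have the same volume in Minkowski space because isometries
have determinant `±1`. -/
lemma IsCoxeter.finite_setOf_form_le (hT : T.IsCoxeter M) (y : Klein) (R : ℝ) :
    {w : M.Group | -form ((T.rep hT.isLiftable w).1 T.center.toMink) y.toMink ≤ R}.Finite := by
  set ρ := T.rep hT.isLiftable
  set c := T.center.toMink with hc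
  -- reflecting in `c` bounds the pairing of `y` with an element of `C` by that with `c`
  set C : Set Mink := {z | z ∈ cone ∧ (∀ i, 0 < form z (T.normal i)) ∧ (2 : ℝ) • c - z ∈ cone}
    with hC
  have hCo : IsOpen C := by
    refine isOpen_cone.inter (IsOpen.inter ?_ ?_)
    · have e : {z : Mink | ∀ i, 0 < form z (T.normal i)} =
          ⋂ i, {z : Mink | 0 < form z (T.normal i)} := by ext z; simp
      change IsOpen {z : Mink | ∀ i, 0 < form z (T.normal i)}
      rw [e]
      exact isOpen_iInter_of_finite fun i => isOpen_lt continuous_const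
        (continuous_form.comp (continuous_id.prodMk continuous_const))
    · exact isOpen_cone.preimage (continuous_const.sub continuous_id)
  have hcC : c ∈ C := ⟨T.center.toMink_mem_cone, T.center_mem_openChamber, by
    rw [two_smul, add_sub_cancel_right]; exact T.center.toMink_mem_cone⟩
  let μ : Measure Mink := Measure.addHaar
  have hvol : ∀ w, μ ((ρ w).1 '' C) = μ C := fun w => by
    have h := Measure.addHaar_image_linearMap μ ((ρ w).1 : Mink →ₗ[ℝ] Mink) C
    have hd : |LinearMap.det ((ρ w).1 : Mink →ₗ[ℝ] Mink)| = 1 := by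
      rw [← detHom_val]
      rcases detHom_rep hT.isLiftable w with h | h <;> rw [h] <;> simp
    rw [hd, ENNReal.ofReal_one, one_mul] at h
    exact h
  have hopen : ∀ w, IsOpen ((ρ w).1 '' C) := fun w =>
    (ρ w).1.toContinuousLinearEquiv.toHomeomorph.isOpenMap C hCo
  let ι := {w : M.Group | -form ((ρ w).1 c) y.toMink ≤ R}
  have hdisj : Pairwise (Function.onFun Disjoint fun w : ι => (ρ w).1 '' C) := by
    intro v w hvw
    rw [Function.onFun, Set.disjoint_left]
    rintro _ ⟨a, ha, rfl⟩ ⟨b, hb, hab⟩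
    apply hvw
    have e : (ρ (v.1⁻¹ * w.1)).1 b = a := by
      rw [rep_mul_apply, hab, ← rep_mul_apply, inv_mul_cancel, rep_one_apply]
    have h1 := hT.eq_one_of_mem (w := v.1⁻¹ * w.1) hb.2.1 (by rw [e]; exact fun i => (ha.2.1 i).le)
    exact Subtype.ext (inv_mul_eq_one.1 h1)
  have hbdd : (⋃ w : ι, (ρ w).1 '' C) ⊆
      Metric.closedBall 0 (2 * R / (1 - ‖y.val‖)) := by
    refine Set.iUnion_subset fun w => ?_
    rintro _ ⟨z, hz, rfl⟩
    have hw : -form ((ρ w).1 c) y.toMink ≤ R := w.2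
    have hz1 := cone_iff.1 (isom_apply_mem_cone (ρ w) hz.1)
    have hz2 := form_neg_of_mem_cone (isom_apply_mem_cone (ρ w) hz.2.2) y.toMink_mem_cone
    rw [map_sub, map_smul, form_sub_left, form_smul_left] at hz2
    have hi := real_inner_le_norm ((ρ w).1 z).1 y.val
    have hy := y.norm_val_lt
    have hn := norm_nonneg ((ρ w).1 z).1
    have hy0 := norm_nonneg y.val
    have hb : ((ρ w).1 z).2 ≤ 2 * R / (1 - ‖y.val‖) := by
      rw [le_div_iff₀ (by linarith)]
      have e : form ((ρ w).1 z) y.toMink = ⟪((ρ w).1 z).1, y.val⟫ - ((ρ w).1 z).2 * 1 := rfl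
      nlinarith
    rw [mem_closedBall_zero_iff, Prod.norm_def]
    refine max_le (by linarith) ?_
    rw [Real.norm_eq_abs, abs_of_pos (by linarith)]
    exact hb
  have hfin := Measure.finite_const_le_meas_of_disjoint_iUnion μ (hCo.measure_pos μ ⟨c, hcC⟩)
    (fun w : ι => (hopen w).measurableSet) hdisj
    ((measure_mono hbdd).trans_lt measure_closedBall_lt_top).ne
  have huniv : {w : ι | μ C ≤ μ ((ρ w).1 '' C)} = Set.univ := by
    ext w; simp [hvol]
  rw [huniv, Set.finite_univ_iff] at hfin
  exact Set.toFinite ι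

lemma IsCoxeter.finite_setOf_dist_le (hT : T.IsCoxeter M) (y : Klein) (R : ℝ) :
    {w : M.Group | (T.rep hT.isLiftable w • T.center).dist y ≤ R}.Finite := by
  refine (hT.finite_setOf_form_le y (Real.cosh R)).subset fun w hw => ?_
  have hw : (T.rep hT.isLiftable w • T.center).dist y ≤ R := hw
  have h1 : Real.cosh ((T.rep hT.isLiftable w • T.center).dist y) ≤ Real.cosh R := by
    rw [Real.cosh_le_cosh, abs_of_nonneg (Klein.dist_nonneg _ _)]
    exact hw.trans (le_abs_self R)
  rw [Klein.cosh_dist, Klein.unit_smul, Klein.unit, Klein.unit, map_smul, form_smul_left,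
    form_smul_right] at h1
  set f := form ((T.rep hT.isLiftable w).1 T.center.toMink) y.toMink with hf
  have hneg : f < 0 := form_neg_of_mem_cone
    (isom_apply_mem_cone _ T.center.toMink_mem_cone) y.toMink_mem_cone
  have hone : ∀ x : Klein, 1 ≤ (√(1 - ‖x.val‖ ^ 2))⁻¹ := fun x => by
    refine (one_le_inv₀ (Real.sqrt_pos.2 x.one_sub_norm_sq_pos)).2 (Real.sqrt_le_one.2 ?_)
    nlinarith [sq_nonneg ‖x.val‖]
  have h2 := one_le_mul_of_one_le_of_one_le (hone T.center) (hone y)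
  change -f ≤ Real.cosh R
  nlinarith

/-- The translates of the tetrahedron cover hyperbolic space: apply to the point the group element
that brings it closest to the centre. -/
theorem IsCoxeter.exists_smul_mem_chamber (hT : T.IsCoxeter M) (y : Klein) :
    ∃ w : M.Group, (T.rep hT.isLiftable w)⁻¹ • y ∈ T.chamber := by
  set ρ := T.rep hT.isLiftable
  set F := fun w : M.Group => -form ((ρ w).1 T.center.toMink) y.toMink with hF
  obtain ⟨w, hw, hmin⟩ := Set.exists_min_image {w | F w ≤ F 1} F
    (hT.finite_setOf_form_le y (F 1)) ⟨1, show F 1 ≤ F 1 from le_rfl⟩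
  have hmin' : ∀ v, F w ≤ F v := fun v => by
    by_cases hv : F v ≤ F 1
    · exact hmin v hv
    · exact (show F w ≤ F 1 from hw).trans (not_le.1 hv).le
  refine ⟨w, (smul_mem_chamber_iff _ _).2 fun i => ?_⟩
  have h := hmin' (w * M.toCoxeterSystem.simple i)
  simp only [hF] at h
  rw [rep_mul_apply, rep_simple, refl_apply, map_sub, map_smul, form_sub_left, form_smul_left] at h
  have hp := T.center_mem_openChamber i
  rw [isom_form_apply_left, inv_inv, form_comm]
  exact nonneg_of_mul_nonneg_right (a := 2 * form T.center.toMink (T.normal i)) (by linarith)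
    (by linarith)

lemma exists_dist_center_le (T : Tetrahedron) :
    ∃ R : ℝ, ∀ x ∈ T.chamber, T.center.dist x ≤ R := by
  obtain ⟨r, hr, h⟩ := T.exists_norm_le
  have hK : IsCompact {x : Klein | ‖x.val‖ ≤ r} := by
    rw [Klein.isInducing_val.isCompact_iff]
    have : Klein.val '' {x | ‖x.val‖ ≤ r} = Metric.closedBall 0 r := by
      ext x
      rw [mem_closedBall_zero_iff]
      exact ⟨fun ⟨y, hy, e⟩ => e ▸ hy, fun hx => ⟨Klein.mk x (hx.trans_lt hr), hx, rfl⟩⟩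
    rw [this]
    exact isCompact_closedBall 0 r
  obtain ⟨R, hR⟩ := (hK.image (Klein.continuous_dist
    (continuous_const (y := T.center)) continuous_id)).bddAbove
  exact ⟨R, fun x hx => hR ⟨x, h _ hx, rfl⟩⟩

open Filter Topology in
/-- Local finiteness: near a point `x`, only the chambers that contain `x` matter. -/
theorem IsCoxeter.eventually_mem_chamber (hT : T.IsCoxeter M) (x : Klein) :
    ∀ᶠ z in 𝓝 x, ∀ w : M.Group, (T.rep hT.isLiftable w)⁻¹ • z ∈ T.chamber →
      (T.rep hT.isLiftable w)⁻¹ • x ∈ T.chamber := by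
  set ρ := T.rep hT.isLiftable
  obtain ⟨R, hR⟩ := T.exists_dist_center_le
  obtain ⟨S, hfin, hS⟩ : ∃ S : Set M.Group, S.Finite ∧
      ∀ w, (ρ w • T.center).dist x ≤ R + 1 → w ∈ S :=
    ⟨_, hT.finite_setOf_dist_le x (R + 1), fun _ h => h⟩
  have hcl : ∀ w, IsClosed {z : Klein | (ρ w)⁻¹ • z ∈ T.chamber} := fun w =>
    T.isClosed_chamber.preimage (Klein.continuous_smul _)
  have h1 : ∀ᶠ z in 𝓝 x, z.dist x < 1 := by
    have hcont : Continuous fun z : Klein => z.dist x :=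
      Klein.continuous_dist continuous_id continuous_const
    have h0 : x.dist x < 1 := by rw [Klein.dist_self]; exact one_pos
    exact (isOpen_lt hcont continuous_const).mem_nhds h0
  have h2 : ∀ᶠ z in 𝓝 x, ∀ w ∈ S,
      (ρ w)⁻¹ • z ∈ T.chamber → (ρ w)⁻¹ • x ∈ T.chamber := by
    refine (eventually_all_finite hfin).2 fun w _ => ?_
    by_cases hx : (ρ w)⁻¹ • x ∈ T.chamber
    · exact Eventually.of_forall fun _ _ => hx
    · filter_upwards [(hcl w).isOpen_compl.mem_nhds hx] with z hz hz'
      exact absurd hz' hz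
  filter_upwards [h1, h2] with z hz1 hz2 w hw
  refine hz2 w (hS w ?_) hw
  have h3 := hR _ hw
  rw [← Klein.dist_smul (ρ w), smul_inv_smul] at h3
  exact (Klein.dist_triangle _ z _).trans (add_le_add h3 hz1.le)

end Tetrahedron

/-! ### The equivariant extension of a linear contraction -/

namespace Tetrahedron

open CoxeterSystem

/-- A linear contraction of the ball with factor `k < 1` that carries the vertices of `T` to the
corresponding vertices of `T'`. -/
structure Contraction (T T' : Tetrahedron) (k : ℝ) where
  map : E3 →ₗ[ℝ] E3
  nonneg : 0 ≤ k
  lt_one : k < 1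
  norm_map_le : ∀ v, ‖map v‖ ≤ k * ‖v‖
  map_vert : ∀ i, map (T.vert i).val = (T'.vert i).val

namespace Contraction

variable {T T' : Tetrahedron} {k : ℝ} (h : T.Contraction T' k)

/-- The contraction as a self-map of the Klein model. -/
def kleinMap (x : Klein) : Klein :=
  Klein.mk (h.map x.val) (by
    have h1 := h.norm_map_le x.val
    have h2 := x.norm_val_lt
    nlinarith [h.lt_one, h.nonneg, norm_nonneg x.val])

lemma kleinMap_val (x : Klein) : (h.kleinMap x).val = h.map x.val := rfl

lemma dist_kleinMap_le (x y : Klein) : (h.kleinMap x).dist (h.kleinMap y) ≤ k * x.dist y :=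
  Klein.dist_le_of_norm_le h.nonneg h.lt_one h.map h.norm_map_le rfl rfl

lemma image_carrier : h.map '' T.carrier = T'.carrier := by
  rw [carrier, carrier, LinearMap.image_convexHull, ← Set.range_comp]
  congr 2
  ext1 i
  exact h.map_vert i

/-- The contraction, extended by the identity in the time direction, carries the hyperplane of each
face of `T` to that of the corresponding face of `T'`, respecting the sides. -/
lemma exists_form_eq (i : Fin 4) : ∃ c > 0, ∀ x : Mink,
    form (h.map x.1, x.2) (T'.normal i) = c * form x (T.normal i) := by
  have hp := T.normal_inward i
  have hp' := T'.normal_inward i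
  refine ⟨_, div_pos hp' hp, fun x => ?_⟩
  let H : Mink →ₗ[ℝ] Mink := h.map.prodMap LinearMap.id
  have hH : ∀ x, T'.vertBasis.repr (H x) = T.vertBasis.repr x := by
    have e : T'.vertBasis.repr.toLinearMap.comp H = T.vertBasis.repr.toLinearMap := by
      refine T.vertBasis.ext fun j => ?_
      have hj : H (T.vertBasis j) = T'.vertBasis j := by
        rw [vertBasis_apply, vertBasis_apply]
        exact Prod.ext (h.map_vert j) rfl
      simp [hj]
    exact fun x => LinearMap.congr_fun e x
  change form (H x) _ = _
  rw [form_normal_eq T' (H x), form_normal_eq T x, hH]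
  field_simp

lemma kleinMap_mem_chamber_iff (x : Klein) : h.kleinMap x ∈ T'.chamber ↔ x ∈ T.chamber := by
  refine forall_congr' fun i => ?_
  obtain ⟨c, hc, hx⟩ := h.exists_form_eq i
  change 0 ≤ form (h.map x.toMink.1, x.toMink.2) _ ↔ _
  rw [hx, mul_nonneg_iff_of_pos_left hc]

lemma kleinMap_mem_openChamber_iff (x : Klein) :
    h.kleinMap x ∈ T'.openChamber ↔ x ∈ T.openChamber := by
  refine forall_congr' fun i => ?_
  obtain ⟨c, hc, hx⟩ := h.exists_form_eq i
  change 0 < form (h.map x.toMink.1, x.toMink.2) _ ↔ _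
  rw [hx, mul_pos_iff_of_pos_left hc]

variable {M : CoxeterMatrix (Fin 4)} (hT : T.IsCoxeter M) (hM : M.IsLiftable T'.refl)

/-- The elements of a stabiliser act trivially on the image of the point. -/
lemma rep_smul_kleinMap {w : M.Group} {x : Klein} (hx : x ∈ T.chamber)
    (hw : T.rep hT.isLiftable w • x ∈ T.chamber) :
    T.rep hT.isLiftable w • x = x ∧ T'.rep hM w • h.kleinMap x = h.kleinMap x := by
  obtain ⟨h1, h2⟩ := hT.apply_eq_and_mem_closure hx ((smul_mem_chamber_iff _ _).1 hw)
  constructor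
  · apply Klein.ext
    rw [smul_val, h1]
    simp [Klein.toMink]
  · have hle : Subgroup.closure (M.toCoxeterSystem.simple '' {i | form x.toMink (T.normal i) = 0})
        ≤ (MulAction.stabilizer Isom (h.kleinMap x)).comap (T'.rep hM) := by
      rw [Subgroup.closure_le]
      rintro _ ⟨i, hi, rfl⟩
      obtain ⟨c, -, hc⟩ := h.exists_form_eq i
      have h0 : form (h.kleinMap x).toMink (T'.normal i) = 0 := by
        change form (h.map x.toMink.1, x.toMink.2) _ = 0
        rw [hc, show form x.toMink (T.normal i) = 0 from hi, mul_zero]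
      change T'.rep hM (M.toCoxeterSystem.simple i) • h.kleinMap x = h.kleinMap x
      rw [rep_simple]
      apply Klein.ext
      rw [smul_val, refl_apply, h0]
      simp [Klein.toMink]
    exact hle h2

/-- The equivariant extension of the contraction: on the translate of `T` by `w`, it is the
contraction conjugated by the two actions of `w`. The chosen `w` is irrelevant by `extend_eq`. -/
def extend (x : Klein) : Klein :=
  T'.rep hM (hT.exists_smul_mem_chamber x).choose •
    h.kleinMap ((T.rep hT.isLiftable (hT.exists_smul_mem_chamber x).choose)⁻¹ • x)

lemma extend_eq {x : Klein} {w : M.Group} (hw : (T.rep hT.isLiftable w)⁻¹ • x ∈ T.chamber) :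
    h.extend hT hM x = T'.rep hM w • h.kleinMap ((T.rep hT.isLiftable w)⁻¹ • x) := by
  rw [extend]
  have hv := (hT.exists_smul_mem_chamber x).choose_spec
  set v := (hT.exists_smul_mem_chamber x).choose
  set a := (T.rep hT.isLiftable w)⁻¹ • x with ha
  have hb : (T.rep hT.isLiftable v)⁻¹ • x = T.rep hT.isLiftable (v⁻¹ * w) • a := by
    rw [ha, map_mul, map_inv, mul_smul, smul_inv_smul]
  rw [hb] at hv ⊢
  obtain ⟨h1, h2⟩ := h.rep_smul_kleinMap hT hM hw hv
  rw [h1]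
  nth_rw 1 [← h2]
  rw [← mul_smul, ← map_mul, mul_inv_cancel_left]

lemma extend_smul (v : M.Group) (x : Klein) :
    h.extend hT hM (T.rep hT.isLiftable v • x) = T'.rep hM v • h.extend hT hM x := by
  obtain ⟨w, hw⟩ := hT.exists_smul_mem_chamber x
  have e : (T.rep hT.isLiftable (v * w))⁻¹ • T.rep hT.isLiftable v • x =
      (T.rep hT.isLiftable w)⁻¹ • x := by
    rw [map_mul, mul_inv_rev, mul_smul, inv_smul_smul]
  rw [h.extend_eq hT hM hw, h.extend_eq hT hM (w := v * w) (by rw [e]; exact hw), e, map_mul,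
    mul_smul]

lemma extend_of_mem {x : Klein} (hx : x ∈ T.chamber) : h.extend hT hM x = h.kleinMap x := by
  have := h.extend_eq hT hM (x := x) (w := 1) (by simpa using hx)
  simpa using this

open Filter Topology

lemma eventually_dist_extend_le (x : Klein) :
    ∀ᶠ z in 𝓝 x, (h.extend hT hM x).dist (h.extend hT hM z) ≤ k * x.dist z := by
  filter_upwards [hT.eventually_mem_chamber x] with z hz
  obtain ⟨w, hw⟩ := hT.exists_smul_mem_chamber z
  rw [h.extend_eq hT hM hw, h.extend_eq hT hM (hz w hw), Klein.dist_smul,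
    ← Klein.dist_smul (T.rep hT.isLiftable w)⁻¹ x z]
  exact h.dist_kleinMap_le _ _

lemma continuous_extend : Continuous (h.extend hT hM) := by
  rw [continuous_iff_continuousAt]
  intro x
  rw [Klein.isInducing_val.continuousAt_iff, ContinuousAt, tendsto_iff_norm_sub_tendsto_zero]
  have hlim : Tendsto (fun z => Real.sinh (k * x.dist z)) (𝓝 x) (𝓝 0) := by
    have hc : Continuous fun z => Real.sinh (k * x.dist z) :=
      Real.continuous_sinh.comp (continuous_const.mul
        (Klein.continuous_dist continuous_const continuous_id))
    have h0 := hc.tendsto x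
    simp only [Klein.dist_self, mul_zero, Real.sinh_zero] at h0
    exact h0
  refine squeeze_zero' (Eventually.of_forall fun _ => norm_nonneg _) ?_ hlim
  filter_upwards [h.eventually_dist_extend_le hT hM x] with z hz
  rw [norm_sub_rev]
  exact (Klein.norm_sub_le_sinh_dist _ _).trans (Real.sinh_le_sinh.2 hz)

end Contraction

end Tetrahedron

/-- A map that is pointwise locally `k`-Lipschitz for the hyperbolic metric is `k`-Lipschitz, by
propagation along geodesics. -/
theorem Klein.dist_le_of_eventually {F : Klein → Klein} {k : ℝ} (hF : Continuous F)
    (h : ∀ x, ∀ᶠ z in nhds x, (F x).dist (F z) ≤ k * x.dist z) (x y : Klein) :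
    (F x).dist (F y) ≤ k * x.dist y := by
  -- the segment from `x` to `y`, constant outside of the unit interval
  let τ : ℝ → ℝ := fun t => max 0 (min 1 t)
  have hτ0 : ∀ t, 0 ≤ τ t := fun t => le_max_left _ _
  have hτ1 : ∀ t, τ t ≤ 1 := fun t => max_le zero_le_one (min_le_left _ _)
  have hτ : ∀ t ∈ Set.Icc (0 : ℝ) 1, τ t = t := fun t ht => by
    simp only [τ]; rw [min_eq_right ht.2, max_eq_right ht.1]
  let γ : ℝ → Klein := fun t => Klein.mk ((1 - τ t) • x.val + τ t • y.val) (by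
    have hc := convex_ball (0 : E3) 1 (mem_ball_zero_iff.2 x.norm_val_lt)
      (mem_ball_zero_iff.2 y.norm_val_lt) (sub_nonneg.2 (hτ1 t)) (hτ0 t) (by ring)
    exact mem_ball_zero_iff.1 hc)
  have hγv : ∀ t ∈ Set.Icc (0 : ℝ) 1, (γ t).val = (1 - t) • x.val + t • y.val := fun t ht => by
    change (1 - τ t) • x.val + τ t • y.val = _
    rw [hτ t ht]
  have hγ : Continuous γ := by
    rw [Klein.isInducing_val.continuous_iff]
    change Continuous fun t => (1 - τ t) • x.val + τ t • y.val
    fun_prop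
  have h0 : γ 0 = x := Klein.ext (by rw [hγv 0 (by simp)]; simp)
  have h1 : γ 1 = y := Klein.ext (by rw [hγv 1 (by simp)]; simp)
  set s := {t : ℝ | (F x).dist (F (γ t)) ≤ k * x.dist (γ t)} with hs
  have hcl : IsClosed s :=
    isClosed_le (continuous_dist continuous_const (hF.comp hγ))
      (continuous_const.mul (continuous_dist continuous_const hγ))
  have hsub : Set.Icc (0 : ℝ) 1 ⊆ s := by
    refine IsClosed.Icc_subset_of_forall_exists_gt (hcl.inter isClosed_Icc) ?_ ?_
    · change (F x).dist (F (γ 0)) ≤ k * x.dist (γ 0)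
      rw [h0, dist_self, dist_self, mul_zero]
    · rintro t ⟨hts, ht0, ht1⟩ u hu
      have hu : t < u := hu
      have e1 : ∀ᶠ t' in nhdsWithin t (Set.Ioi t),
          (F (γ t)).dist (F (γ t')) ≤ k * (γ t).dist (γ t') :=
        (hγ.tendsto t).mono_left nhdsWithin_le_nhds |>.eventually (h (γ t))
      obtain ⟨t', h2, h3, h4⟩ :=
        (e1.and (Ioc_mem_nhdsGT (lt_min hu ht1))).exists
      refine ⟨t', ?_, h3, h4.trans (min_le_left _ _)⟩
      have h5 : t' ≤ 1 := h4.trans (min_le_right _ _)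
      have hpos : 0 < t' := ht0.trans_lt h3
      have hseg := dist_add_dist_of_segment (x := x) (y := γ t) (z := γ t') (s := t / t')
        (by positivity) ((div_le_one hpos).2 h3.le) (by
          rw [hγv t ⟨ht0, ht1.le⟩, hγv t' ⟨hpos.le, h5⟩, smul_add, smul_smul, smul_smul,
            div_mul_cancel₀ _ hpos.ne', ← add_assoc, ← add_smul]
          congr 2
          field_simp
          ring)
      have hts : (F x).dist (F (γ t)) ≤ k * x.dist (γ t) := hts
      change (F x).dist (F (γ t')) ≤ k * x.dist (γ t')
      rw [← hseg, mul_add]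
      exact (dist_triangle _ _ _).trans (add_le_add hts h2)
  have := hsub (Set.right_mem_Icc.2 zero_le_one)
  rw [hs, Set.mem_ofPred_eq, h1] at this
  exact this

namespace Tetrahedron

variable {T T' : Tetrahedron} {M : CoxeterMatrix (Fin 4)}

lemma rep_mem_reflectionGroup (hM : M.IsLiftable T.refl) (w : M.Group) :
    T.rep hM w ∈ T.reflectionGroup := by
  refine M.toCoxeterSystem.simple_induction (p := fun w => T.rep hM w ∈ T.reflectionGroup) w
    (fun i => ?_) ?_ fun v w hv hw => ?_
  · rw [rep_simple]
    exact Subgroup.subset_closure ⟨i, rfl⟩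
  · rw [map_one]; exact one_mem _
  · rw [map_mul]; exact mul_mem hv hw

lemma reflectionGroup_le_range (hM : M.IsLiftable T.refl) :
    T.reflectionGroup ≤ (T.rep hM).range := by
  rw [reflectionGroup, Subgroup.closure_le]
  rintro _ ⟨i, rfl⟩
  exact ⟨M.toCoxeterSystem.simple i, rep_simple hM i⟩

lemma mem_rotationGroup_iff {A : Isom} :
    A ∈ T.rotationGroup ↔ A ∈ T.reflectionGroup ∧ detHom A = 1 := Iff.rfl

lemma IsCoxeter.rep_injective (hT : T.IsCoxeter M) :
    Function.Injective (T.rep hT.isLiftable) := by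
  rw [injective_iff_map_eq_one]
  intro w hw
  refine hT.eq_one_of_mem (x := T.center.toMink) T.center_mem_openChamber ?_
  rw [hw]
  exact T.openChamber_subset T.center_mem_openChamber

/-- The homomorphism of rotation groups that sends products of reflections in the faces of `T` to
the corresponding products of reflections in the faces of `T'`. It is well defined because the
reflection group of `T` is the abstract Coxeter group. -/
def IsCoxeter.rotationHom (hT : T.IsCoxeter M) (hM : M.IsLiftable T'.refl) :
    T.rotationGroup →* T'.rotationGroup :=
  MonoidHom.codRestrict
    (((T'.rep hM).comp (MonoidHom.ofInjective hT.rep_injective).symm.toMonoidHom).comp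
      (Subgroup.inclusion (inf_le_left.trans (reflectionGroup_le_range hT.isLiftable))))
    T'.rotationGroup fun g => by
      refine mem_rotationGroup_iff.2 ⟨rep_mem_reflectionGroup hM _, ?_⟩
      have hg := (mem_rotationGroup_iff.1 g.2).2
      rw [MonoidHom.comp_apply, MonoidHom.comp_apply, detHom_rep_eq hM hT.isLiftable]
      refine Eq.trans (congrArg detHom ?_) hg
      exact MonoidHom.apply_ofInjective_symm hT.rep_injective _

lemma IsCoxeter.rotationHom_eq (hT : T.IsCoxeter M) (hM : M.IsLiftable T'.refl)
    {g : T.rotationGroup} {w : M.Group} (hw : T.rep hT.isLiftable w = g.1) :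
    (hT.rotationHom hM g).1 = T'.rep hM w := by
  change T'.rep hM ((MonoidHom.ofInjective hT.rep_injective).symm _) = _
  congr 1
  apply hT.rep_injective
  rw [hw]
  exact MonoidHom.apply_ofInjective_symm hT.rep_injective _

/-- The equivariant extension of a contraction as a map of orbifolds. -/
def Contraction.orbifoldMap {k : ℝ} (h : T.Contraction T' k) (hT : T.IsCoxeter M)
    (hM : M.IsLiftable T'.refl) : OrbifoldMap T.rotationGroup T'.rotationGroup where
  lift := h.extend hT hM
  hom := hT.rotationHom hM
  continuous_lift := h.continuous_extend hT hM
  equivariant g x := by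
    obtain ⟨w, hw⟩ := reflectionGroup_le_range hT.isLiftable (mem_rotationGroup_iff.1 g.2).1
    rw [Subgroup.smul_def, Subgroup.smul_def, hT.rotationHom_eq hM hw, ← hw, h.extend_smul]

end Tetrahedron

/-- A map of orbifolds inherits the Lipschitz constant of its lift. -/
lemma OrbifoldMap.dist_map_le {Γ Γ' : Subgroup Isom} (f : OrbifoldMap Γ Γ') {k : ℝ} (hk : 0 ≤ k)
    (hf : ∀ x y, (f.lift x).dist (f.lift y) ≤ k * x.dist y) (p q : Orbifold Γ) :
    Orbifold.dist (f.map p) (f.map q) ≤ k * Orbifold.dist p q := by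
  have hbdd : ∀ {Δ : Subgroup Isom} (a b : Orbifold Δ),
      BddBelow {r | ∃ x y : Klein, Orbifold.proj Δ x = a ∧ Orbifold.proj Δ y = b ∧ r = x.dist y} :=
    fun a b => ⟨0, by rintro _ ⟨x, y, -, -, rfl⟩; exact Klein.dist_nonneg x y⟩
  have hne : {r | ∃ x y : Klein,
      Orbifold.proj Γ x = p ∧ Orbifold.proj Γ y = q ∧ r = x.dist y}.Nonempty := by
    obtain ⟨x, rfl⟩ := Quotient.exists_rep p
    obtain ⟨y, rfl⟩ := Quotient.exists_rep q
    exact ⟨_, x, y, rfl, rfl, rfl⟩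
  rw [Orbifold.dist, Orbifold.dist, ← smul_eq_mul, ← Real.sInf_smul_of_nonneg hk]
  refine le_csInf (hne.smul_set) ?_
  rintro _ ⟨_, ⟨x, y, rfl, rfl, rfl⟩, rfl⟩
  exact (csInf_le (hbdd _ _) ⟨f.lift x, f.lift y, (f.map_proj x).symm, (f.map_proj y).symm,
    rfl⟩).trans (hf x y)

/-! ### Jacobians of projective maps -/

/-- The action of an isometry on the Klein model, in coordinates. -/
def projMap (A : Isom) (z : E3) : E3 := (A.1 (z, 1)).2⁻¹ • (A.1 (z, 1)).1

lemma projMap_val (A : Isom) (x : Klein) : projMap A x.val = (A • x).val := rfl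

/-- The Jacobian determinant of a projective transformation `A` is `det A / t ^ 4`, where `t` is the
time component of the image vector; in particular it has the sign of `det A`. -/
lemma exists_hasFDerivAt_projMap (A : Isom) (x : Klein) :
    ∃ L : E3 →L[ℝ] E3, HasFDerivAt (projMap A) L x.val ∧
      ∃ c > 0, (detHom A : ℝ) = c * L.det := by
  set t := (A.1 x.toMink).2 with ht
  have ht0 : 0 < t := isom_apply_snd_pos A x
  set y := (A.1 x.toMink).1 with hy
  let Ac : Mink →L[ℝ] Mink := (A.1.toContinuousLinearEquiv : Mink →L[ℝ] Mink)
  let D : E3 →L[ℝ] Mink := Ac.comp (ContinuousLinearMap.inl ℝ E3 ℝ)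
  let P : E3 →L[ℝ] E3 := (ContinuousLinearMap.fst ℝ E3 ℝ).comp D
  let q : E3 →L[ℝ] ℝ := (ContinuousLinearMap.snd ℝ E3 ℝ).comp D
  have hd : HasFDerivAt (fun z : E3 => A.1 (z, 1)) D x.val :=
    Ac.hasFDerivAt.comp x.val (hasFDerivAt_prodMk_left x.val (1 : ℝ))
  have hL := ((hasDerivAt_inv ht0.ne').comp_hasFDerivAt x.val hd.snd).smul hd.fst
  refine ⟨_, hL, t ^ 4, by positivity, ?_⟩
  -- the derivative is `t⁻¹ • N`
  let N : E3 →ₗ[ℝ] E3 := P - LinearMap.smulRight (q : E3 →ₗ[ℝ] ℝ) (t⁻¹ • y)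
  -- `A` sends `(x, 1)` to `t • (y / t, 1)`, so after shears that move these two vectors to the time
  -- axis it becomes block triangular, with diagonal blocks `N` and `t`
  have hN : ∀ L : E3 →L[ℝ] E3, (∀ v, L v = t⁻¹ • N v) → (detHom A : ℝ) = t ^ 4 * L.det := by
    intro L hL
    have e : (L : E3 →ₗ[ℝ] E3) = t⁻¹ • N := LinearMap.ext hL
    have e2 : (A.1 : Mink →ₗ[ℝ] Mink) ∘ₗ
        LinearMap.transvection (LinearMap.snd ℝ E3 ℝ) ((x.val, 0) : Mink) =
        LinearMap.transvection (LinearMap.snd ℝ E3 ℝ) ((t⁻¹ • y, 0) : Mink) ∘ₗ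
        (N.prodMap (t • LinearMap.id)) ∘ₗ
        LinearMap.transvection ((t⁻¹ • (q : E3 →ₗ[ℝ] ℝ)) ∘ₗ LinearMap.fst ℝ E3 ℝ)
          ((0, 1) : Mink) := by
      apply LinearMap.ext
      rintro ⟨v, s⟩
      have e3 : ((v, s) : Mink) + s • ((x.val, 0) : Mink) = (v, 0) + s • x.toMink := by
        ext1 <;> simp [Klein.toMink]
      have e4 : A.1 (v, 0) = (P v, q v) := rfl
      have e5 : A.1 x.toMink = (y, t) := rfl
      simp only [LinearMap.comp_apply, LinearMap.transvection.apply, LinearMap.snd_apply,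
        LinearEquiv.coe_coe, LinearMap.fst_apply, LinearMap.smul_apply]
      rw [e3, map_add, map_smul, e4, e5]
      have hNv : N v = P v - q v • t⁻¹ • y := rfl
      ext1
      · change P v + s • y = N (v + (t⁻¹ * q v) • (0 : E3)) +
          (t * (s + t⁻¹ * q v * 1)) • t⁻¹ • y
        rw [smul_zero, add_zero, hNv]
        match_scalars <;> field_simp
        ring
      · change q v + s * t = t * (s + t⁻¹ * q v * 1) +
          (t * (s + t⁻¹ * q v * 1)) * 0
        field_simp
        ring
    have e6 := congrArg LinearMap.det e2
    rw [LinearMap.det_comp, LinearMap.det_comp, LinearMap.det_comp, LinearMap.transvection.det,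
      LinearMap.transvection.det, LinearMap.transvection.det, LinearMap.det_prodMap] at e6
    simp only [LinearMap.snd_apply, LinearMap.comp_apply, LinearMap.fst_apply, map_zero, add_zero,
      mul_one, one_mul, LinearMap.det_smul, LinearMap.det_id, Module.finrank_self, pow_one] at e6
    rw [detHom_val, e6, ContinuousLinearMap.det, e, LinearMap.det_smul]
    simp only [finrank_euclideanSpace, Fintype.card_fin]
    field_simp
  refine hN _ fun v => ?_
  change (A.1 (x.val, 1)).2⁻¹ • (A.1 (v, 0)).1 +
    (-((A.1 (x.val, 1)).2 ^ 2)⁻¹ • (A.1 (v, 0)).2) • (A.1 (x.val, 1)).1 =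
    t⁻¹ • ((A.1 (v, 0)).1 - (A.1 (v, 0)).2 • t⁻¹ • y)
  change t⁻¹ • (A.1 (v, 0)).1 + (-(t ^ 2)⁻¹ • (A.1 (v, 0)).2) • y = _
  rw [smul_eq_mul]
  match_scalars <;> field_simp

lemma Klein.map_val_nhds (x : Klein) : Filter.map Klein.val (nhds x) = nhds x.val :=
  (Metric.isOpen_ball.isOpenEmbedding_subtypeVal).map_nhds_eq x

lemma OrbifoldMap.coordLift_val {Γ Γ' : Subgroup Isom} (f : OrbifoldMap Γ Γ') (x : Klein) :
    f.coordLift x.val = (f.lift x).val := by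
  rw [coordLift, dif_pos x.norm_val_lt]
  rfl

/-! ### The degree of the extension -/

namespace Tetrahedron

variable {T T' : Tetrahedron} {M M' : CoxeterMatrix (Fin 4)} {k : ℝ}

/-- The extension preserves the orientation in the interior of each chamber: there, it is the
conjugate of the linear contraction by two isometries with equal determinants. -/
lemma Contraction.jacobian_pos (h : T.Contraction T' k) (hT : T.IsCoxeter M)
    (hM : M.IsLiftable T'.refl) (hdet : 0 < LinearMap.det h.map) {w : M.Group} {x : Klein}
    (hx : (T.rep hT.isLiftable w)⁻¹ • x ∈ T.openChamber) :
    DifferentiableAt ℝ (h.orbifoldMap hT hM).coordLift x.val ∧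
      0 < (h.orbifoldMap hT hM).jacobian x := by
  set A := (T.rep hT.isLiftable w)⁻¹ with hA
  set B := T'.rep hM w with hB
  have hloc : (h.orbifoldMap hT hM).coordLift =ᶠ[nhds x.val]
      fun z => projMap B (h.map (projMap A z)) := by
    rw [← Klein.map_val_nhds, Filter.EventuallyEq, Filter.eventually_map]
    filter_upwards [(T.isOpen_openChamber.preimage (Klein.continuous_smul A)).mem_nhds hx]
      with z hz
    rw [OrbifoldMap.coordLift_val, projMap_val, ← kleinMap_val, projMap_val]
    exact congrArg Klein.val (h.extend_eq hT hM (T.openChamber_subset hz))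
  obtain ⟨L₁, hL₁, c₁, hc₁, hd₁⟩ := exists_hasFDerivAt_projMap A x
  obtain ⟨L₂, hL₂, c₂, hc₂, hd₂⟩ := exists_hasFDerivAt_projMap B (h.kleinMap (A • x))
  have hcomp : HasFDerivAt (fun z => projMap B (h.map (projMap A z)))
      (L₂.comp ((LinearMap.toContinuousLinearMap h.map).comp L₁)) x.val := by
    have h1 : HasFDerivAt (fun z => h.map (projMap A z))
        ((LinearMap.toContinuousLinearMap h.map).comp L₁) x.val :=
      (LinearMap.toContinuousLinearMap h.map).hasFDerivAt.comp x.val hL₁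
    exact HasFDerivAt.comp x.val (f := fun z => h.map (projMap A z)) hL₂ h1
  have hF := hcomp.congr_of_eventuallyEq hloc
  refine ⟨hF.differentiableAt, ?_⟩
  rw [OrbifoldMap.jacobian, hF.fderiv]
  have hdets : (L₂.comp ((LinearMap.toContinuousLinearMap h.map).comp L₁)).det =
      L₂.det * (LinearMap.det h.map * L₁.det) := by
    change LinearMap.det ((L₂ : E3 →ₗ[ℝ] E3) ∘ₗ h.map ∘ₗ (L₁ : E3 →ₗ[ℝ] E3)) = _
    rw [LinearMap.det_comp, LinearMap.det_comp]
  have hAB : (detHom A : ℝ) * detHom B = 1 := by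
    rw [← Units.val_mul, hA, map_inv, hB, detHom_rep_eq hM hT.isLiftable, inv_mul_cancel,
      Units.val_one]
  rw [hdets]
  rw [hd₁, hd₂] at hAB
  have hp : 0 < c₁ * c₂ := mul_pos hc₁ hc₂
  have h12 : 0 < L₁.det * L₂.det := by
    by_contra hn
    nlinarith [mul_nonneg hp.le (neg_nonneg.2 (not_lt.1 hn))]
  nlinarith [mul_pos hdet h12]

open MeasureTheory in
/-- Almost every point of the ball lies in the interior of a chamber: the walls lie in countably
many planes. -/
lemma IsCoxeter.ae_mem_openChamber (hT : T.IsCoxeter M) :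
    ∀ᵐ y : E3, ∀ hy : ‖y‖ < 1,
      ∃ w : M.Group, (T.rep hT.isLiftable w)⁻¹ • Klein.mk y hy ∈ T.openChamber := by
  have : Countable M.Group := M.toCoxeterSystem.wordProd_surjective.countable
  have hnull : ∀ (w : M.Group) (i : Fin 4), ∀ᵐ y : E3,
      form (y, 1) ((T.rep hT.isLiftable w).1 (T.normal i)) ≠ 0 := fun w i => by
    set u := (T.rep hT.isLiftable w).1 (T.normal i) with hu
    have hu1 : form u u = 1 := by rw [hu, isom_form_apply, T.normal_unit]
    have hu0 : u.1 ≠ 0 := fun h0 => by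
      simp only [form, h0, inner_zero_left] at hu1
      nlinarith [sq_nonneg u.2]
    -- the wall, as an affine plane
    let S : AffineSubspace ℝ E3 :=
      { carrier := {y | ⟪y, u.1⟫ = u.2}
        smul_vsub_vadd_mem' := fun c p₁ p₂ p₃ h₁ h₂ h₃ => by
          have h₁ : ⟪p₁, u.1⟫ = u.2 := h₁
          have h₂ : ⟪p₂, u.1⟫ = u.2 := h₂
          have h₃ : ⟪p₃, u.1⟫ = u.2 := h₃
          change ⟪c • (p₁ - p₂) + p₃, u.1⟫ = u.2
          rw [inner_add_left, real_inner_smul_left, inner_sub_left, h₁, h₂, h₃]; ring }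
    have hS : S ≠ ⊤ := fun hS => by
      have h1 : ∀ y : E3, ⟪y, u.1⟫ = u.2 := fun y => by
        have : y ∈ S := hS ▸ AffineSubspace.mem_top ℝ E3 y
        exact this
      have h2 := h1 0
      rw [inner_zero_left] at h2
      have h3 := h1 u.1
      rw [← h2, inner_self_eq_zero] at h3
      exact hu0 h3
    have hz := Measure.addHaar_affineSubspace volume S hS
    rw [ae_iff]
    refine measure_mono_null (fun y hy => ?_) hz
    have hy : ¬form (y, 1) u ≠ 0 := hy
    change ⟪y, u.1⟫ = u.2
    simp only [form, not_not, one_mul] at hy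
    linarith
  filter_upwards [ae_all_iff.2 fun w => ae_all_iff.2 (hnull w)] with y hy hy1
  obtain ⟨w, hw⟩ := hT.exists_smul_mem_chamber (Klein.mk y hy1)
  refine ⟨w, (smul_mem_openChamber_iff _ _).2 fun i => ?_⟩
  have h1 := (smul_mem_chamber_iff _ _).1 hw i
  rw [isom_form_apply_left, inv_inv] at h1 ⊢
  exact lt_of_le_of_ne h1 (hy w i).symm

lemma Contraction.kleinMap_injective (h : T.Contraction T' k) (hdet : LinearMap.det h.map ≠ 0) :
    Function.Injective h.kleinMap := fun x y hxy => by
  have h1 : h.map x.val = h.map y.val := congrArg Klein.val hxy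
  exact Klein.ext ((h.map.equivOfDetNeZero hdet).injective h1)

lemma Contraction.exists_kleinMap_eq (h : T.Contraction T' k) (hdet : LinearMap.det h.map ≠ 0)
    {y : Klein} (hy : y ∈ T'.chamber) : ∃ x, h.kleinMap x = y := by
  obtain ⟨u, hu⟩ := (h.map.equivOfDetNeZero hdet).surjective y.val
  have hu : h.map u = y.val := hu
  obtain ⟨r, hr, hT⟩ := T.exists_norm_le
  have hu1 : ‖u‖ < 1 := by
    refine (hT u fun i => ?_).trans_lt hr
    obtain ⟨c, hc, hx⟩ := h.exists_form_eq i
    have h1 := hx (u, 1)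
    rw [hu] at h1
    have h2 : 0 ≤ form (y.val, 1) (T'.normal i) := hy i
    rw [h1] at h2
    exact nonneg_of_mul_nonneg_right h2 hc
  exact ⟨Klein.mk u hu1, Klein.ext hu⟩

lemma orbifold_proj_eq_iff {Γ : Subgroup Isom} {x y : Klein} :
    Orbifold.proj Γ x = Orbifold.proj Γ y ↔ ∃ g ∈ Γ, g • y = x := by
  constructor
  · intro h
    obtain ⟨g, hg⟩ := Quotient.exact h
    exact ⟨g.1, g.2, hg⟩
  · rintro ⟨g, hg, rfl⟩
    exact Quotient.sound ⟨⟨g, hg⟩, rfl⟩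

/-- The extension of an orientation preserving contraction has degree one: a generic orbit of the
target meets the open tetrahedron `T'`, possibly after a reflection, in exactly one point, and its
preimages are the translates of one point of `T` by elements of a fixed orientation character. -/
theorem Contraction.hasDegree_one (h : T.Contraction T' k) (hT : T.IsCoxeter M)
    (hM : M.IsLiftable T'.refl) (hT' : T'.IsCoxeter M') (hdet : 0 < LinearMap.det h.map) :
    (h.orbifoldMap hT hM).HasDegree 1 := by
  filter_upwards [hT'.ae_mem_openChamber] with y hy hy1
  obtain ⟨u, hu⟩ := hy hy1
  set Y := Klein.mk y hy1 with hY
  set f := h.orbifoldMap hT hM with hf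
  set y₀ := (T'.rep hT'.isLiftable u)⁻¹ • Y with hy₀
  have hY₀ : T'.rep hT'.isLiftable u • y₀ = Y := smul_inv_smul _ _
  obtain ⟨x₀, hx₀⟩ := h.exists_kleinMap_eq hdet.ne' (T'.openChamber_subset hu)
  have hx₀' : x₀ ∈ T.openChamber := by
    rw [← h.kleinMap_mem_openChamber_iff, hx₀]; exact hu
  -- the preimages of the orbit of `Y`
  have hpre : ∀ x : Klein, f.map (Orbifold.proj _ x) = Orbifold.proj _ Y →
      ∃ v : M.Group, x = T.rep hT.isLiftable v • x₀ ∧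
        detHom (T.rep hT.isLiftable v) = detHom (T'.rep hT'.isLiftable u) := by
    intro x hx
    rw [OrbifoldMap.map_proj, orbifold_proj_eq_iff] at hx
    obtain ⟨g, hg, hgx⟩ := hx
    obtain ⟨v, hv⟩ := hT.exists_smul_mem_chamber x
    have hlift : f.lift x = _ := h.extend_eq hT hM hv
    set a := (T.rep hT.isLiftable v)⁻¹ • x with ha
    have hmem : (T'.rep hM v)⁻¹ * g * T'.rep hT'.isLiftable u ∈ T'.reflectionGroup :=
      mul_mem (mul_mem (inv_mem (rep_mem_reflectionGroup hM v)) (mem_rotationGroup_iff.1 hg).1)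
        (rep_mem_reflectionGroup hT'.isLiftable u)
    obtain ⟨z, hz⟩ := reflectionGroup_le_range hT'.isLiftable hmem
    have hza : T'.rep hT'.isLiftable z • y₀ = h.kleinMap a := by
      rw [hz, mul_smul, mul_smul, hY₀, hgx, hlift, inv_smul_smul]
    have hz1 : z = 1 := by
      refine hT'.eq_one_of_mem (x := y₀.toMink) hu ?_
      rw [← smul_mem_chamber_iff, hza, h.kleinMap_mem_chamber_iff]
      exact hv
    subst hz1
    rw [map_one, one_smul, ← hx₀] at hza
    refine ⟨v, ?_, ?_⟩
    · rw [h.kleinMap_injective hdet.ne' hza, ha, smul_inv_smul]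
    · have h1 := congrArg detHom hz
      rw [map_one, map_one, map_mul, map_mul, map_inv, (mem_rotationGroup_iff.1 hg).2, mul_one,
        detHom_rep_eq hM hT.isLiftable] at h1
      exact inv_mul_eq_one.1 h1.symm
  -- one preimage
  obtain ⟨v₀, hv₀⟩ : ∃ v : M.Group,
      detHom (T.rep hT.isLiftable v) = detHom (T'.rep hT'.isLiftable u) := by
    rcases detHom_rep hT'.isLiftable u with h1 | h1
    · exact ⟨1, by rw [map_one, map_one, h1]⟩
    · exact ⟨M.toCoxeterSystem.simple 0, by rw [rep_simple, detHom_refl, h1]⟩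
  set q₀ := Orbifold.proj T.rotationGroup (T.rep hT.isLiftable v₀ • x₀) with hq₀
  have hq₀f : f.map q₀ = Orbifold.proj _ Y := by
    rw [hq₀, OrbifoldMap.map_proj, orbifold_proj_eq_iff]
    refine ⟨T'.rep hM v₀ * (T'.rep hT'.isLiftable u)⁻¹, ?_, ?_⟩
    · refine mem_rotationGroup_iff.2 ⟨mul_mem (rep_mem_reflectionGroup hM v₀)
        (inv_mem (rep_mem_reflectionGroup hT'.isLiftable u)), ?_⟩
      rw [map_mul, map_inv, detHom_rep_eq hM hT.isLiftable, hv₀, mul_inv_cancel]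
    · rw [mul_smul, ← hy₀, ← hx₀]
      have := h.extend_smul hT hM v₀ x₀
      rw [h.extend_of_mem hT hM (T.openChamber_subset hx₀')] at this
      exact this.symm
  have hset : {q | f.map q = Orbifold.proj _ Y} = {q₀} := by
    ext q
    rw [Set.mem_singleton_iff]
    refine ⟨fun hq => ?_, fun hq => hq ▸ hq₀f⟩
    obtain ⟨x, rfl⟩ := Quotient.exists_rep q
    obtain ⟨v, rfl, hv⟩ := hpre x hq
    refine orbifold_proj_eq_iff.2 ⟨T.rep hT.isLiftable v * (T.rep hT.isLiftable v₀)⁻¹,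
      mem_rotationGroup_iff.2 ⟨mul_mem (rep_mem_reflectionGroup _ v)
        (inv_mem (rep_mem_reflectionGroup _ v₀)), ?_⟩, ?_⟩
    · rw [map_mul, map_inv, hv, hv₀, mul_inv_cancel]
    · rw [mul_smul, inv_smul_smul]
  have hjac : ∀ x : Klein, f.map (Orbifold.proj _ x) = Orbifold.proj _ Y →
      DifferentiableAt ℝ f.coordLift x.val ∧ 0 < f.jacobian x := by
    intro x hx
    obtain ⟨v, rfl, -⟩ := hpre x hx
    exact h.jacobian_pos hT hM hdet (w := v) (by rw [inv_smul_smul]; exact hx₀')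
  refine ⟨?_, fun x hx => ⟨(hjac x hx).1, (hjac x hx).2.ne'⟩, ?_⟩
  · rw [hset]; exact Set.finite_singleton _
  · refine (finsum_mem_congr hset fun _ _ => rfl).trans ?_
    rw [finsum_mem_singleton]
    have hout : Orbifold.proj T.rotationGroup q₀.out = q₀ := Quotient.out_eq q₀
    rw [sign_pos (hjac q₀.out (by rw [hout]; exact hq₀f)).2]
    rfl

end Tetrahedron

/-! ### The trihedral corner with angles `π/2`, `π/3`, `π/5` -/

open Real (goldenRatio)

lemma cos_pi_div_five_eq : Real.cos (Real.pi / 5) = goldenRatio / 2 := by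
  rw [Real.cos_pi_div_five, goldenRatio]; ring

/-- The Gram matrix of the inward normals of the corner. -/
def cornerGram : Matrix (Fin 3) (Fin 3) ℝ :=
  !![1, -(goldenRatio / 2), -(1 / 2); -(goldenRatio / 2), 1, 0; -(1 / 2), 0, 1]

/-- The inverse of the Gram matrix of the corner. -/
def cornerInv : Matrix (Fin 3) (Fin 3) ℝ :=
  !![4 * goldenRatio + 4, 4 * goldenRatio + 2, 2 * goldenRatio + 2;
    4 * goldenRatio + 2, 3 * goldenRatio + 3, 2 * goldenRatio + 1;
    2 * goldenRatio + 2, 2 * goldenRatio + 1, goldenRatio + 2]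

lemma cornerInv_mul_cornerGram : cornerInv * cornerGram = 1 := by
  have h := Real.goldenRatio_sq
  ext i j
  fin_cases i <;> fin_cases j <;>
    simp [cornerInv, cornerGram, Matrix.mul_apply, Fin.sum_univ_three] <;> linarith

/-- Three vectors of `ℝ³` with the Gram matrix of the corner. -/
def IsCornerFrame (e : Fin 3 → E3) : Prop := ∀ i j, ⟪e i, e j⟫ = cornerGram i j

/-- The basis dual to a corner frame; its elements span the edges of the corner. -/
def dualFrame (e : Fin 3 → E3) (i : Fin 3) : E3 := ∑ j, cornerInv i j • e j

namespace IsCornerFrame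

variable {e : Fin 3 → E3}

lemma inner_dualFrame (he : IsCornerFrame e) (i j : Fin 3) :
    ⟪dualFrame e i, e j⟫ = if i = j then 1 else 0 := by
  rw [dualFrame, sum_inner]
  simp only [real_inner_smul_left, he _ _]
  have h := congrFun (congrFun cornerInv_mul_cornerGram i) j
  rwa [Matrix.mul_apply, Matrix.one_apply] at h

lemma inner_sum_dualFrame (he : IsCornerFrame e) (c : Fin 3 → ℝ) (j : Fin 3) :
    ⟪∑ i, c i • dualFrame e i, e j⟫ = c j := by
  rw [sum_inner]
  simp [real_inner_smul_left, he.inner_dualFrame]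

/-- The dual frame as a basis. -/
def dualBasis (he : IsCornerFrame e) : Module.Basis (Fin 3) ℝ E3 :=
  basisOfLinearIndependentOfCardEqFinrank (b := dualFrame e)
    (by
      rw [Fintype.linearIndependent_iff]
      intro c hc i
      rw [← he.inner_sum_dualFrame c i, hc, inner_zero_left])
    (by simp)

lemma dualBasis_apply (he : IsCornerFrame e) (i : Fin 3) : he.dualBasis i = dualFrame e i := by
  simp [dualBasis]

lemma sum_inner_smul_dualFrame (he : IsCornerFrame e) (x : E3) :
    ∑ i, ⟪x, e i⟫ • dualFrame e i = x := by
  have h := he.dualBasis.sum_repr x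
  simp only [dualBasis_apply] at h
  have hr : ∀ i, ⟪x, e i⟫ = he.dualBasis.repr x i := fun i => by
    rw [← he.inner_sum_dualFrame (fun i => he.dualBasis.repr x i) i, h]
  simp only [hr]
  exact h

lemma ext_inner (he : IsCornerFrame e) {x y : E3} (h : ∀ i, ⟪x, e i⟫ = ⟪y, e i⟫) : x = y := by
  rw [← he.sum_inner_smul_dualFrame x, ← he.sum_inner_smul_dualFrame y]
  simp only [h]

lemma inner_eq (he : IsCornerFrame e) (x y : E3) :
    ⟪x, y⟫ = ∑ i, ∑ j, cornerInv i j * ⟪x, e i⟫ * ⟪y, e j⟫ := by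
  nth_rw 1 [← he.sum_inner_smul_dualFrame x]
  rw [sum_inner]
  refine Finset.sum_congr rfl fun i _ => ?_
  rw [real_inner_smul_left, dualFrame, sum_inner, Finset.mul_sum]
  refine Finset.sum_congr rfl fun j _ => ?_
  rw [real_inner_smul_left, real_inner_comm y]
  ring

end IsCornerFrame

/-- The linear map that scales the `i`-th edge of the corner by the factor `l i`. -/
def edgeScaling (e : Fin 3 → E3) (l : Fin 3 → ℝ) : E3 →ₗ[ℝ] E3 :=
  ∑ i, l i • (innerSL ℝ (e i) : E3 →ₗ[ℝ] ℝ).smulRight (dualFrame e i)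

lemma edgeScaling_apply (e : Fin 3 → E3) (l : Fin 3 → ℝ) (x : E3) :
    edgeScaling e l x = ∑ i, (l i * ⟪x, e i⟫) • dualFrame e i := by
  simp [edgeScaling, real_inner_comm x, mul_smul]

namespace IsCornerFrame

variable {e : Fin 3 → E3}

lemma inner_edgeScaling (he : IsCornerFrame e) (l : Fin 3 → ℝ) (x : E3) (i : Fin 3) :
    ⟪edgeScaling e l x, e i⟫ = l i * ⟪x, e i⟫ := by
  rw [edgeScaling_apply, he.inner_sum_dualFrame]

lemma det_edgeScaling (he : IsCornerFrame e) (l : Fin 3 → ℝ) :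
    LinearMap.det (edgeScaling e l) = ∏ i, l i := by
  rw [← LinearMap.det_toMatrix he.dualBasis]
  have h : LinearMap.toMatrix he.dualBasis he.dualBasis (edgeScaling e l) = Matrix.diagonal l := by
    ext i j
    have hs : edgeScaling e l (he.dualBasis j) = l j • he.dualBasis j := by
      apply he.ext_inner
      intro k
      rw [he.inner_edgeScaling, real_inner_smul_left, dualBasis_apply, he.inner_dualFrame]
      by_cases hk : j = k
      · subst hk; rfl
      · simp [hk]
    rw [LinearMap.toMatrix_apply, hs, map_smul, Module.Basis.repr_self]
    by_cases hij : i = j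
    · subst hij; simp
    · simp [hij]
  rw [h, Matrix.det_diagonal]

end IsCornerFrame

/-! ### Numerical bounds -/

open Real (goldenRatio)

lemma goldenRatio_bounds : 1.6180339887 ≤ goldenRatio ∧ goldenRatio ≤ 1.6180339888 := by
  have h1 : (2.2360679774 : ℝ) ≤ √5 := Real.le_sqrt_of_sq_le (by norm_num)
  have h2 : √5 ≤ (2.2360679776 : ℝ) := Real.sqrt_le_iff.2 ⟨by norm_num, by norm_num⟩
  unfold goldenRatio
  constructor <;> linarith

lemma cos_pi_div_four_bounds :
    0.7071067811 ≤ Real.cos (Real.pi / 4) ∧ Real.cos (Real.pi / 4) ≤ 0.7071067812 := by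
  have h1 : (1.4142135622 : ℝ) ≤ √2 := Real.le_sqrt_of_sq_le (by norm_num)
  have h2 : √2 ≤ (1.4142135624 : ℝ) := Real.sqrt_le_iff.2 ⟨by norm_num, by norm_num⟩
  rw [Real.cos_pi_div_four]
  constructor <;> linarith

/-- The coefficients, in the dual frame, of the space part of the normal of a face that meets the
faces of the corner at angles with cosines `0`, `1 / 2` and `x`. -/
def faceCoeff (x : ℝ) : Fin 3 → ℝ :=
  ![-(2 * goldenRatio + 1 + (2 * goldenRatio + 2) * x),
    -((3 * goldenRatio + 3) / 2 + (2 * goldenRatio + 1) * x),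
    -((2 * goldenRatio + 1) / 2 + (goldenRatio + 2) * x)]

/-- The square of the time part of the normal of that face. -/
def faceHeight (x : ℝ) : ℝ :=
  (3 * goldenRatio - 1) / 4 + (2 * goldenRatio + 1) * x + (goldenRatio + 2) * x ^ 2

lemma faceCoeff_neg {x : ℝ} (hx : 0 ≤ x) (j : Fin 3) : faceCoeff x j < 0 := by
  have h := Real.goldenRatio_pos
  fin_cases j <;> simp [faceCoeff] <;> nlinarith [mul_nonneg h.le hx]

/-- Bounds for the ratios of the lengths of corresponding edges at the common vertex of the
tetrahedra with remaining angle `π / 2` and `π / 4`. -/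
lemma edge_ratio_bounds {l : Fin 3 → ℝ} (hl : ∀ j, 0 < l j)
    (h : ∀ j, l j ^ 2 * (faceCoeff 0 j ^ 2 * faceHeight (Real.cos (Real.pi / 4))) =
      faceHeight 0 * faceCoeff (Real.cos (Real.pi / 4)) j ^ 2) :
    (0.765949 ≤ l 0 ∧ l 0 ≤ 0.7659494) ∧ (0.7204655 ≤ l 1 ∧ l 1 ≤ 0.7204659) ∧
      (0.9023994 ≤ l 2 ∧ l 2 ≤ 0.9023998) := by
  obtain ⟨p1, p2⟩ := goldenRatio_bounds
  obtain ⟨x1, x2⟩ := cos_pi_div_four_bounds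
  have hp := Real.goldenRatio_sq
  have hx : Real.cos (Real.pi / 4) ^ 2 = 1 / 2 := by
    rw [Real.cos_pi_div_four, div_pow, Real.sq_sqrt (by norm_num)]; norm_num
  have h0 := h 0
  have h1 := h 1
  have h2 := h 2
  simp only [faceCoeff, faceHeight, Matrix.cons_val] at h0 h1 h2
  set φ := goldenRatio
  set x := Real.cos (Real.pi / 4)
  have y1 : 1.1441228052 ≤ φ * x :=
    le_trans (by norm_num) (mul_le_mul p1 x1 (by norm_num) (by linarith))
  have y2 : φ * x ≤ 1.1441228059 :=
    (mul_le_mul p2 x2 (by linarith) (by norm_num)).trans (by norm_num)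
  have l0 := hl 0
  have l1 := hl 1
  have l2 := hl 2
  clear h hl
  clear_value φ x
  generalize l 0 = u at *
  generalize l 1 = v at *
  generalize l 2 = w at *
  -- both sides are reduced modulo `φ² = φ + 1` and `x² = 1 / 2`
  have e0 : u ^ 2 * (55 / 4 + 21 * x + 89 / 4 * φ + 34 * (φ * x)) =
      33 / 4 + 12 * x + 55 / 4 * φ + 19 * (φ * x) := by
    linear_combination h0 + (5 + 13 * x + 8 * x ^ 2 + 3 * φ + 6 * φ * x + 3 * φ * x ^ 2) * hp +
      (7 + 12 * φ) * hx - u ^ 2 * ((5 + 20 * x + 16 * x ^ 2 + 3 * φ + 8 * φ * x +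
        4 * φ * x ^ 2) * hp + (18 + 29 * φ) * hx)
  have e1 : v ^ 2 * (189 / 16 + 18 * x + 153 / 8 * φ + 117 / 4 * (φ * x)) =
      101 / 16 + 9 * x + 85 / 8 * φ + 57 / 4 * (φ * x) := by
    linear_combination h1 + (9 / 2 + 39 / 4 * x + 5 * x ^ 2 + 27 / 16 * φ + 9 / 2 * φ * x +
      3 * φ * x ^ 2) * hp + (19 / 4 + 31 / 4 * φ) * hx - v ^ 2 * ((9 / 2 + 63 / 4 * x +
        45 / 4 * x ^ 2 + 27 / 16 * φ + 9 / 2 * φ * x + 9 / 4 * φ * x ^ 2) * hp +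
        (63 / 4 + 99 / 4 * φ) * hx)
  have e2 : w ^ 2 * (55 / 16 + 21 / 4 * x + 89 / 16 * φ + 17 / 2 * (φ * x)) =
      39 / 16 + 17 / 4 * x + 81 / 16 * φ + 13 / 2 * (φ * x) := by
    linear_combination h2 + (5 / 4 + 19 / 4 * x + 7 / 2 * x ^ 2 + 3 / 4 * φ + 3 / 2 * φ * x +
      3 / 4 * φ * x ^ 2) * hp + (5 / 2 + 25 / 4 * φ) * hx - w ^ 2 * ((5 / 4 + 5 * x +
        4 * x ^ 2 + 3 / 4 * φ + 2 * φ * x + φ * x ^ 2) * hp + (9 / 2 + 29 / 4 * φ) * hx)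
  have key : ∀ {t a b D N : ℝ}, 0 < t → 0 ≤ a → 0 ≤ b → 0 < D → t ^ 2 * D = N → a ^ 2 * D ≤ N →
      N ≤ b ^ 2 * D → a ≤ t ∧ t ≤ b := by
    intro t a b D N ht ha hb hD he h1 h2
    rw [← he] at h1 h2
    exact ⟨le_of_sq_le_sq (le_of_mul_le_mul_right h1 hD) ht.le,
      le_of_sq_le_sq (le_of_mul_le_mul_right h2 hD) hb⟩
  refine ⟨key l0 ?_ ?_ ?_ e0 ?_ ?_, key l1 ?_ ?_ ?_ e1 ?_ ?_,
    key l2 ?_ ?_ ?_ e2 ?_ ?_⟩ <;> linarith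

/-- Positivity of a ternary quadratic form, from its leading principal minors. -/
lemma ternary_form_nonneg {a b c d e f : ℝ} (ha : 0 < a) (had : 0 < a * d - b ^ 2)
    (hdet : 0 ≤ (a * d - b ^ 2) * (a * f - c ^ 2) - (a * e - b * c) ^ 2) (x y z : ℝ) :
    0 ≤ a * x ^ 2 + 2 * b * x * y + 2 * c * x * z + d * y ^ 2 + 2 * e * y * z + f * z ^ 2 := by
  have h : 0 ≤ a * (a * d - b ^ 2) *
      (a * x ^ 2 + 2 * b * x * y + 2 * c * x * z + d * y ^ 2 + 2 * e * y * z + f * z ^ 2) := by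
    have e1 : a * (a * d - b ^ 2) *
        (a * x ^ 2 + 2 * b * x * y + 2 * c * x * z + d * y ^ 2 + 2 * e * y * z + f * z ^ 2) =
        (a * d - b ^ 2) * (a * x + b * y + c * z) ^ 2 +
        ((a * d - b ^ 2) * y + (a * e - b * c) * z) ^ 2 +
        ((a * d - b ^ 2) * (a * f - c ^ 2) - (a * e - b * c) ^ 2) * z ^ 2 := by ring
    rw [e1]
    have := mul_nonneg hdet (sq_nonneg z)
    positivity
  exact nonneg_of_mul_nonneg_right h (by positivity)

/-- A ternary quadratic form stays nonnegative when its off-diagonal coefficients move by at most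
`ε`, if the diagonal has `2 ε` to spare. -/
lemma ternary_form_nonneg_of_close {a b c d e f b' c' e' ε : ℝ} (hb : |b - b'| ≤ ε)
    (hc : |c - c'| ≤ ε) (he : |e - e'| ≤ ε) (x y z : ℝ)
    (h : 0 ≤ (a - 2 * ε) * x ^ 2 + 2 * b' * x * y + 2 * c' * x * z + (d - 2 * ε) * y ^ 2 +
      2 * e' * y * z + (f - 2 * ε) * z ^ 2) :
    0 ≤ a * x ^ 2 + 2 * b * x * y + 2 * c * x * z + d * y ^ 2 + 2 * e * y * z + f * z ^ 2 := by
  have key : ∀ {δ : ℝ}, |δ| ≤ ε → ∀ s t : ℝ, 0 ≤ ε * s ^ 2 + 2 * δ * s * t + ε * t ^ 2 := by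
    intro δ hδ s t
    obtain ⟨h1, h2⟩ := abs_le.1 hδ
    nlinarith [mul_nonneg (by linarith : 0 ≤ ε + δ) (sq_nonneg (s + t)),
      mul_nonneg (by linarith : 0 ≤ ε - δ) (sq_nonneg (s - t))]
  nlinarith [key hb x y, key hc x z, key he y z]

lemma cornerInv_form (c : Fin 3 → ℝ) : ∑ i, ∑ j, cornerInv i j * c i * c j =
    (4 * goldenRatio + 4) * c 0 ^ 2 + 2 * (4 * goldenRatio + 2) * c 0 * c 1 +
      2 * (2 * goldenRatio + 2) * c 0 * c 2 + (3 * goldenRatio + 3) * c 1 ^ 2 +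
      2 * (2 * goldenRatio + 1) * c 1 * c 2 + (goldenRatio + 2) * c 2 ^ 2 := by
  simp only [Fin.sum_univ_three, cornerInv, Matrix.of_apply, Matrix.cons_val]
  ring

/-- The scaling of the edges contracts Euclidean norms by the factor `0.977`. -/
lemma cornerInv_form_le {l : Fin 3 → ℝ} (h0 : 0.765949 ≤ l 0 ∧ l 0 ≤ 0.7659494)
    (h1 : 0.7204655 ≤ l 1 ∧ l 1 ≤ 0.7204659) (h2 : 0.9023994 ≤ l 2 ∧ l 2 ≤ 0.9023998)
    (c : Fin 3 → ℝ) :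
    ∑ i, ∑ j, cornerInv i j * (l i * c i) * (l j * c j) ≤
      0.977 ^ 2 * ∑ i, ∑ j, cornerInv i j * c i * c j := by
  rw [cornerInv_form c, cornerInv_form fun i => l i * c i, ← sub_nonneg]
  obtain ⟨p1, p2⟩ := goldenRatio_bounds
  set φ := goldenRatio
  -- interval arithmetic for the entries `(0.977 ^ 2 - l i * l j) * cornerInv i j`
  have key : ∀ {s t a b s₁ s₂ t₁ t₂ : ℝ}, s₁ ≤ s ∧ s ≤ s₂ → t₁ ≤ t ∧ t ≤ t₂ → 0 ≤ s₁ → 0 ≤ t₁ →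
      s₂ * t₂ ≤ 0.977 ^ 2 → ∀ (A B : ℝ), 0 ≤ A → 0 ≤ B →
      a ≤ (0.977 ^ 2 - s₂ * t₂) * (A * 1.6180339887 + B) →
      (0.977 ^ 2 - s₁ * t₁) * (A * 1.6180339888 + B) ≤ b →
      a ≤ (0.977 ^ 2 - s * t) * (A * φ + B) ∧ (0.977 ^ 2 - s * t) * (A * φ + B) ≤ b := by
    intro s t a b s₁ s₂ t₁ t₂ hs ht hs0 ht0 hst A B hA hB ha hb
    have q1 : s₁ * t₁ ≤ s * t := mul_le_mul hs.1 ht.1 ht0 (hs0.trans hs.1)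
    have q2 : s * t ≤ s₂ * t₂ :=
      mul_le_mul hs.2 ht.2 (ht0.trans ht.1) (hs0.trans (hs.1.trans hs.2))
    have q3 : A * 1.6180339887 + B ≤ A * φ + B := by gcongr
    have q4 : A * φ + B ≤ A * 1.6180339888 + B := by gcongr
    have q5 : 0 ≤ A * 1.6180339887 + B := by positivity
    exact ⟨ha.trans (mul_le_mul (by linarith) q3 q5 (by linarith)),
      le_trans (mul_le_mul (by linarith) q4 (q5.trans q3) (by linarith)) hb⟩
  have m00 := key (a := 3.852178) (b := 3.852191) h0 h0 (by norm_num) (by norm_num) (by norm_num)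
    4 4 (by norm_num) (by norm_num) (by norm_num) (by norm_num)
  have m01 := key (a := 3.411629) (b := 3.411641) h0 h1 (by norm_num) (by norm_num) (by norm_num)
    4 2 (by norm_num) (by norm_num) (by norm_num) (by norm_num)
  have m02 := key (a := 1.378845) (b := 1.378853) h0 h2 (by norm_num) (by norm_num) (by norm_num)
    2 2 (by norm_num) (by norm_num) (by norm_num) (by norm_num)
  have m11 := key (a := 3.420128) (b := 3.420138) h1 h1 (by norm_num) (by norm_num) (by norm_num)
    3 3 (by norm_num) (by norm_num) (by norm_num) (by norm_num)
  have m12 := key (a := 1.289376) (b := 1.289382) h1 h2 (by norm_num) (by norm_num) (by norm_num)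
    2 1 (by norm_num) (by norm_num) (by norm_num) (by norm_num)
  have m22 := key (a := 0.507260) (b := 0.507265) h2 h2 (by norm_num) (by norm_num) (by norm_num)
    1 2 (by norm_num) (by norm_num) (by norm_num) (by norm_num)
  -- round the matrix to rational entries, leaving the diagonal enough room for the errors
  have hform := ternary_form_nonneg_of_close (ε := 0.00001)
    (a := (0.977 ^ 2 - l 0 * l 0) * (4 * φ + 4)) (b := (0.977 ^ 2 - l 0 * l 1) * (4 * φ + 2))
    (c := (0.977 ^ 2 - l 0 * l 2) * (2 * φ + 2)) (d := (0.977 ^ 2 - l 1 * l 1) * (3 * φ + 3))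
    (e := (0.977 ^ 2 - l 1 * l 2) * (2 * φ + 1)) (f := (0.977 ^ 2 - l 2 * l 2) * (1 * φ + 2))
    (b' := 3.411635) (c' := 1.378849) (e' := 1.289379)
    (abs_le.2 ⟨by linarith [m01.1], by linarith [m01.2]⟩)
    (abs_le.2 ⟨by linarith [m02.1], by linarith [m02.2]⟩)
    (abs_le.2 ⟨by linarith [m12.1], by linarith [m12.2]⟩) (c 0) (c 1) (c 2) (by
      have h := ternary_form_nonneg (a := 3.852158) (b := 3.411635) (c := 1.378849)
        (d := 3.420108) (e := 1.289379) (f := 0.507240) (by norm_num) (by norm_num) (by norm_num)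
        (c 0) (c 1) (c 2)
      nlinarith [mul_nonneg (sub_nonneg.2 m00.1) (sq_nonneg (c 0)),
        mul_nonneg (sub_nonneg.2 m11.1) (sq_nonneg (c 1)),
        mul_nonneg (sub_nonneg.2 m22.1) (sq_nonneg (c 2))])
  refine hform.trans_eq ?_
  ring

/-! ### The two tetrahedra -/

/-- The Coxeter matrix of the tetrahedra `T(2,3,m;2,3,5)`. -/
def cornerMatrix (m : ℕ) (hm : m ≠ 1) : CoxeterMatrix (Fin 4) where
  M := !![1, 5, 3, 2; 5, 1, 2, 3; 3, 2, 1, m; 2, 3, m, 1]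
  isSymm := by ext i j; fin_cases i <;> fin_cases j <;> rfl
  diagonal i := by fin_cases i <;> rfl
  off_diagonal i j h := by fin_cases i <;> fin_cases j <;> simp_all

/-- A symmetric property of the entries of the Coxeter matrix may be checked on the diagonal and
above it. -/
lemma cornerMatrix_forall {m : ℕ} {hm : m ≠ 1} {P : Fin 4 → Fin 4 → ℕ → Prop}
    (hs : ∀ i j k, P i j k → P j i k) (hd : ∀ i, P i i 1) (h01 : P 0 1 5) (h02 : P 0 2 3)
    (h03 : P 0 3 2) (h12 : P 1 2 2) (h13 : P 1 3 3) (h23 : P 2 3 m) (i j : Fin 4) :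
    P i j (cornerMatrix m hm i j) := by
  fin_cases i <;> fin_cases j
  exacts [hd 0, h01, h02, h03, hs _ _ _ h01, hd 1, h12, h13, hs _ _ _ h02, hs _ _ _ h12, hd 2, h23,
    hs _ _ _ h03, hs _ _ _ h13, hs _ _ _ h23, hd 3]

namespace Tetrahedron

variable {T T' : Tetrahedron} {m : ℕ}

/-- A dihedral angle strictly between `0` and `π` determines the Gram matrix entry. -/
lemma form_eq_of_dihedralAngle {i j : Fin 4} (hm : 2 ≤ m)
    (h : T.dihedralAngle i j = Real.pi / m) :
    form (T.normal i) (T.normal j) = -Real.cos (Real.pi / m) := by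
  have hm' : (2 : ℝ) ≤ m := by exact_mod_cast hm
  have hpos : 0 < Real.pi / m := by positivity
  have hlt : Real.pi / m < Real.pi := div_lt_self Real.pi_pos (by linarith)
  rw [dihedralAngle] at h
  -- outside of `[-1, 1]` the function `arccos` only takes the values `0` and `π`
  have h1 : -1 ≤ -form (T.normal i) (T.normal j) := by
    by_contra hn
    rw [Real.arccos_of_le_neg_one (not_le.1 hn).le] at h
    exact hlt.ne h.symm
  have h2 : -form (T.normal i) (T.normal j) ≤ 1 := by
    by_contra hn
    rw [Real.arccos_of_one_le (not_le.1 hn).le] at h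
    exact hpos.ne h
  rw [← h, Real.cos_arccos h1 h2, neg_neg]

lemma HasType.isCoxeter (hm : 2 ≤ m) (h : T.HasType 2 3 m 2 3 5) :
    T.IsCoxeter (cornerMatrix m (by omega)) := by
  obtain ⟨h03, h13, h23, h12, h02, h01⟩ := h
  replace h03 := form_eq_of_dihedralAngle le_rfl h03
  replace h13 := form_eq_of_dihedralAngle (by norm_num) h13
  replace h23 := form_eq_of_dihedralAngle hm h23
  replace h12 := form_eq_of_dihedralAngle le_rfl h12
  replace h02 := form_eq_of_dihedralAngle (by norm_num) h02
  replace h01 := form_eq_of_dihedralAngle (by norm_num) h01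
  have hd : ∀ i, form (T.normal i) (T.normal i) = -Real.cos (Real.pi / (1 : ℕ)) := fun i => by
    simp [T.normal_unit]
  refine cornerMatrix_forall
    (P := fun i j k => k ≠ 0 ∧ form (T.normal i) (T.normal j) = -Real.cos (Real.pi / k))
    (fun i j k h => ⟨h.1, (form_comm _ _).trans h.2⟩) (fun i => ⟨one_ne_zero, hd i⟩)
    ⟨by norm_num, h01⟩ ⟨by norm_num, h02⟩ ⟨by norm_num, h03⟩ ⟨by norm_num, h12⟩
    ⟨by norm_num, h13⟩ ⟨by omega, h23⟩

lemma isLiftable_cornerMatrix_of_dvd {m m' : ℕ} {hm : m ≠ 1} {hm' : m' ≠ 1} (h : m' ∣ m)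
    (hT : (cornerMatrix m' hm').IsLiftable T.refl) : (cornerMatrix m hm).IsLiftable T.refl := by
  have hd : ∀ i j, cornerMatrix m' hm' i j ∣ cornerMatrix m hm i j :=
    cornerMatrix_forall (P := fun i j k => cornerMatrix m' hm' i j ∣ k)
      (fun i j k h => by rwa [(cornerMatrix m' hm').symmetric]) (fun i => by simp)
      (dvd_refl 5) (dvd_refl 3) (dvd_refl 2) (dvd_refl 2) (dvd_refl 3) h
  intro i j
  obtain ⟨c, hc⟩ := hd i j
  rw [hc, pow_mul, hT i j, one_pow]

/-- The space parts of the normals of the three faces at the distinguished vertex. -/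
def cornerNormal (T : Tetrahedron) (i : Fin 3) : E3 := (T.normal i.castSucc).1

lemma normal_castSucc (h0 : (T.vert 3).val = 0) (i : Fin 3) :
    T.normal i.castSucc = (T.cornerNormal i, 0) := by
  refine Prod.ext rfl ?_
  have h := T.normal_face i.castSucc 3 (by fin_cases i <;> decide)
  simp only [form, Klein.toMink, h0, inner_zero_left, one_mul, zero_sub, neg_eq_zero] at h
  exact h

lemma form_normal_castSucc (h0 : (T.vert 3).val = 0) (i : Fin 3) (x : Mink) :
    form x (T.normal i.castSucc) = ⟪x.1, T.cornerNormal i⟫ := by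
  rw [normal_castSucc h0]; simp [form]

lemma HasType.isCornerFrame (hm : 2 ≤ m) (h : T.HasType 2 3 m 2 3 5) (h0 : (T.vert 3).val = 0) :
    IsCornerFrame T.cornerNormal := by
  have hc := h.isCoxeter hm
  intro i j
  have hij := (hc i.castSucc j.castSucc).2
  rw [form_normal_castSucc h0] at hij
  change ⟪T.cornerNormal i, T.cornerNormal j⟫ = _ at hij
  rw [hij]
  have h5 : Real.cos (Real.pi / (5 : ℕ)) = goldenRatio / 2 := by
    exact_mod_cast cos_pi_div_five_eq
  have h3 : Real.cos (Real.pi / (3 : ℕ)) = 1 / 2 := by exact_mod_cast Real.cos_pi_div_three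
  have h2 : Real.cos (Real.pi / (2 : ℕ)) = 0 := by exact_mod_cast Real.cos_pi_div_two
  have h1 : -Real.cos (Real.pi / (1 : ℕ)) = 1 := by simp
  have h2' : -Real.cos (Real.pi / (2 : ℕ)) = 0 := by rw [h2, neg_zero]
  have h3' := congrArg Neg.neg h3
  have h5' := congrArg Neg.neg h5
  fin_cases i <;> fin_cases j
  exacts [h1, h5', h3', h5', h1, h2', h3', h2', h1]

lemma inner_vert_cornerNormal_of_ne (h0 : (T.vert 3).val = 0) {i j : Fin 3} (hij : j ≠ i) :
    ⟪(T.vert j.castSucc).val, T.cornerNormal i⟫ = 0 := by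
  rw [← T.normal_face i.castSucc j.castSucc (by simpa using hij), form_normal_castSucc h0]
  rfl

lemma inner_vert_cornerNormal_pos (h0 : (T.vert 3).val = 0) (i : Fin 3) :
    0 < ⟪(T.vert i.castSucc).val, T.cornerNormal i⟫ := by
  have h := T.normal_inward i.castSucc
  rw [form_normal_castSucc h0] at h
  exact h

lemma cornerInv_mul_faceAngles (x : ℝ) (j : Fin 3) :
    ∑ k, cornerInv j k * (![0, -(1 / 2), -x] : Fin 3 → ℝ) k = faceCoeff x j := by
  fin_cases j <;> simp [Fin.sum_univ_three, cornerInv, faceCoeff] <;> ring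

lemma sum_faceAngles_mul_faceCoeff (x : ℝ) :
    ∑ k, (![0, -(1 / 2), -x] : Fin 3 → ℝ) k * faceCoeff x k = faceHeight x + 1 := by
  simp [Fin.sum_univ_three, faceHeight, faceCoeff]; ring

lemma _root_.Agol.IsCornerFrame.inner_eq_sum_faceCoeff {e : Fin 3 → E3} (he : IsCornerFrame e)
    {x : ℝ} {a : E3} (ha : ∀ i, ⟪a, e i⟫ = (![0, -(1 / 2), -x] : Fin 3 → ℝ) i) (v : E3) :
    ⟪v, a⟫ = ∑ j, ⟪v, e j⟫ * faceCoeff x j := by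
  rw [he.inner_eq]
  refine Finset.sum_congr rfl fun i _ => ?_
  rw [← cornerInv_mul_faceAngles, Finset.mul_sum]
  refine Finset.sum_congr rfl fun j _ => ?_
  rw [ha]; ring

/-- The position of the vertices on the edges of the corner: `b` is the time part of the normal of
the fourth face. -/
lemma HasType.exists_vert_eq (hm : 2 ≤ m) (h : T.HasType 2 3 m 2 3 5)
    (h0 : (T.vert 3).val = 0) : ∃ b < 0, b ^ 2 = faceHeight (Real.cos (Real.pi / m)) ∧
      ∀ j : Fin 3, ⟪(T.vert j.castSucc).val, T.cornerNormal j⟫ *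
        faceCoeff (Real.cos (Real.pi / m)) j = b := by
  have he := h.isCornerFrame hm h0
  set x := Real.cos (Real.pi / m)
  have ha : ∀ i, ⟪(T.normal 3).1, T.cornerNormal i⟫ = (![0, -(1 / 2), -x] : Fin 3 → ℝ) i := by
    have h03 := form_eq_of_dihedralAngle le_rfl h.1
    have h13 := form_eq_of_dihedralAngle (by norm_num) h.2.1
    have h23 := form_eq_of_dihedralAngle hm h.2.2.1
    rw [form_comm] at h03 h13 h23
    intro i
    rw [← form_normal_castSucc h0]
    fin_cases i
    · refine h03.trans ?_
      simp
    · refine h13.trans ?_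
      rw [show ((3 : ℕ) : ℝ) = 3 by norm_num, Real.cos_pi_div_three]; rfl
    · exact h23
  have hb : form (T.vert 3).toMink (T.normal 3) = -(T.normal 3).2 := by
    simp [form, Klein.toMink, h0]
  have hb0 := T.normal_inward 3
  rw [hb] at hb0
  refine ⟨(T.normal 3).2, by linarith, ?_, fun j => ?_⟩
  · have hu := T.normal_unit 3
    rw [form, he.inner_eq_sum_faceCoeff ha] at hu
    simp only [ha] at hu
    rw [sum_faceAngles_mul_faceCoeff] at hu
    linarith
  · have hf := T.normal_face 3 j.castSucc (by fin_cases j <;> decide)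
    have hf2 : ⟪(T.vert j.castSucc).val, (T.normal 3).1⟫ = (T.normal 3).2 := by
      simp only [form, Klein.toMink, one_mul] at hf
      linarith
    rw [← hf2, he.inner_eq_sum_faceCoeff ha, Finset.sum_eq_single j]
    · intro i _ hij
      rw [inner_vert_cornerNormal_of_ne h0 hij.symm, zero_mul]
    · simp

/-- The contraction of `T(2,3,4;2,3,5)` onto `T(2,3,2;2,3,5)` by rescaling the edges at the common
vertex. -/
lemma exists_contraction (h₂ : T'.HasType 2 3 2 2 3 5) (h₄ : T.HasType 2 3 4 2 3 5)
    (hc : T'.SharesCorner T) :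
    ∃ h : T.Contraction T' 0.977, 0 < LinearMap.det h.map := by
  obtain ⟨h0', h0, hn⟩ := hc
  have hee : T'.cornerNormal = T.cornerNormal := by
    ext1 i
    rw [cornerNormal, cornerNormal, hn _ (by fin_cases i <;> decide)]
  have he := h₄.isCornerFrame (by norm_num) h0
  obtain ⟨b', hb', hB', hv'⟩ := h₂.exists_vert_eq le_rfl h0'
  obtain ⟨b, hb, hB, hv⟩ := h₄.exists_vert_eq (by norm_num) h0
  have hp := inner_vert_cornerNormal_pos h0
  have hp' := inner_vert_cornerNormal_pos h0'
  rw [hee] at hv' hp'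
  have hx2 : Real.cos (Real.pi / (2 : ℕ)) = 0 := by exact_mod_cast Real.cos_pi_div_two
  have hx4 : Real.cos (Real.pi / (4 : ℕ)) = Real.cos (Real.pi / 4) := by norm_num
  rw [hx2] at hv' hB'
  rw [hx4] at hv hB
  set e := T.cornerNormal
  -- the ratios of the lengths of the edges at the common vertex
  set l : Fin 3 → ℝ := fun j => ⟪(T'.vert j.castSucc).val, e j⟫ / ⟪(T.vert j.castSucc).val, e j⟫
    with hl
  have hlpos : ∀ j, 0 < l j := fun j => div_pos (hp' j) (hp j)
  have hlv : ∀ j, l j * ⟪(T.vert j.castSucc).val, e j⟫ = ⟪(T'.vert j.castSucc).val, e j⟫ :=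
    fun j => div_mul_cancel₀ _ (hp j).ne'
  have hlsq : ∀ j, l j ^ 2 * (faceCoeff 0 j ^ 2 * faceHeight (Real.cos (Real.pi / 4))) =
      faceHeight 0 * faceCoeff (Real.cos (Real.pi / 4)) j ^ 2 := fun j => by
    rw [← hB, ← hB', ← hv' j, ← hv j, ← hlv j]; ring
  obtain ⟨q0, q1, q2⟩ := edge_ratio_bounds hlpos hlsq
  refine ⟨⟨edgeScaling e l, by norm_num, by norm_num, fun v => ?_, fun i => ?_⟩, ?_⟩
  · refine le_of_sq_le_sq ?_ (by positivity)
    rw [mul_pow, ← real_inner_self_eq_norm_sq, ← real_inner_self_eq_norm_sq, he.inner_eq,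
      he.inner_eq v]
    simp only [he.inner_edgeScaling]
    exact cornerInv_form_le q0 q1 q2 fun i => ⟪v, e i⟫
  · refine Fin.lastCases ?_ (fun j => ?_) i
    · change edgeScaling e l (T.vert 3).val = (T'.vert 3).val
      rw [h0, h0', map_zero]
    · apply he.ext_inner
      intro i
      rw [he.inner_edgeScaling]
      by_cases hij : j = i
      · subst hij; exact hlv j
      · have h1 := inner_vert_cornerNormal_of_ne h0 hij
        have h2 := inner_vert_cornerNormal_of_ne h0' hij
        rw [hee] at h2
        rw [h2, h1, mul_zero]
  · change 0 < LinearMap.det (edgeScaling e l)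
    rw [he.det_edgeScaling]
    exact Finset.prod_pos fun j _ => hlpos j

end Tetrahedron

/-! ### Existence of the tetrahedra -/

/-- An explicit choice of the normals of the three faces at the distinguished vertex. -/
def stdCorner : Fin 3 → E3 :=
  ![!₂[-(goldenRatio / 2), -(1 / 2), √(2 - goldenRatio) / 2], !₂[1, 0, 0], !₂[0, 1, 0]]

lemma isCornerFrame_stdCorner : IsCornerFrame stdCorner := by
  have h := Real.goldenRatio_sq
  have h2 := goldenRatio_bounds
  have hs := Real.sq_sqrt (by linarith : 0 ≤ 2 - goldenRatio)
  intro i j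
  fin_cases i <;> fin_cases j <;>
    simp [stdCorner, cornerGram, PiLp.inner_apply, Fin.sum_univ_three, -inner_self_eq_norm_sq_to_K]
  linarith

/-- The tetrahedron with the given corner whose fourth face makes angles with cosines `0`, `1 / 2`
and `x` with the faces of the corner. -/
lemma exists_tetrahedron {x : ℝ} (hx : 0 ≤ x)
    (hbd : ∀ j, faceHeight x * cornerInv j j < faceCoeff x j ^ 2) :
    ∃ T : Tetrahedron, (T.vert 3).val = 0 ∧ (∀ i : Fin 3, T.normal i.castSucc = (stdCorner i, 0)) ∧
      ∀ i : Fin 3, form (T.normal i.castSucc) (T.normal 3) =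
        (![0, -(1 / 2), -x] : Fin 3 → ℝ) i := by
  have he := isCornerFrame_stdCorner
  set e := stdCorner
  have hB : 0 < faceHeight x := by
    have h := goldenRatio_bounds
    have h1 : 0 ≤ (2 * goldenRatio + 1) * x := mul_nonneg (by linarith) hx
    have h2 : 0 ≤ (goldenRatio + 2) * x ^ 2 := mul_nonneg (by linarith) (sq_nonneg x)
    unfold faceHeight
    linarith
  set b := -√(faceHeight x) with hb
  have hbneg : b < 0 := neg_neg_of_pos (Real.sqrt_pos.2 hB)
  have hb2 : b ^ 2 = faceHeight x := by rw [hb, neg_sq, Real.sq_sqrt hB.le]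
  have hc := faceCoeff_neg hx
  set g : Fin 3 → ℝ := ![0, -(1 / 2), -x] with hg
  set a : E3 := ∑ i, g i • dualFrame e i with ha
  have hae : ∀ i, ⟪a, e i⟫ = g i := fun i => he.inner_sum_dualFrame g i
  have hva := he.inner_eq_sum_faceCoeff hae
  have haa : ⟪a, a⟫ = faceHeight x + 1 := by
    rw [hva]
    simp only [hae]
    exact Tetrahedron.sum_faceAngles_mul_faceCoeff x
  -- the intersection of the `j`-th edge of the corner with the face of normal `(a, b)`
  let v : Fin 3 → E3 := fun j => (b / faceCoeff x j) • dualFrame e j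
  have hve : ∀ i j, ⟪v j, e i⟫ = if j = i then b / faceCoeff x j else 0 := fun i j => by
    simp only [v]
    rw [real_inner_smul_left, he.inner_dualFrame]
    split_ifs <;> simp
  have hvn : ∀ j, ‖v j‖ < 1 := fun j => by
    have h1 : ‖v j‖ ^ 2 = faceHeight x * cornerInv j j / faceCoeff x j ^ 2 := by
      rw [← real_inner_self_eq_norm_sq, he.inner_eq, Finset.sum_eq_single j]
      · rw [Finset.sum_eq_single j]
        · rw [hve, if_pos rfl, ← hb2]; ring
        · intro i _ hij
          rw [hve i, if_neg hij.symm, mul_zero]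
        · simp
      · intro i _ hij
        simp [hve i, hij.symm]
      · simp
    have h2 : ‖v j‖ ^ 2 < 1 := by
      rw [h1, div_lt_one (by have := (hc j).ne; positivity)]
      exact hbd j
    exact (sq_lt_one_iff₀ (norm_nonneg _)).1 h2
  have hvab : ∀ j, ⟪v j, a⟫ = b := fun j => by
    rw [hva, Finset.sum_eq_single j]
    · rw [hve, if_pos rfl, div_mul_cancel₀ _ (hc j).ne]
    · intro i _ hij
      rw [hve, if_neg hij.symm, zero_mul]
    · simp
  have hcases : ∀ i : Fin 4, i = Fin.last 3 ∨ ∃ j : Fin 3, i = j.castSucc := fun i =>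
    Fin.lastCases (Or.inl rfl) (fun j => Or.inr ⟨j, rfl⟩) i
  let V : Fin 4 → Klein := Fin.snoc (α := fun _ => Klein) (fun j => Klein.mk (v j) (hvn j))
    (Klein.mk 0 (by simp))
  let n : Fin 4 → Mink := Fin.snoc (α := fun _ => Mink) (fun i => ((e i, 0) : Mink)) (a, b)
  have hVc : ∀ j, (V (Fin.castSucc j)).toMink = (v j, 1) := fun j => by
    simp only [V, Fin.snoc_castSucc]; rfl
  have hVl : (V (Fin.last 3)).toMink = (0, 1) := by
    simp only [V, Fin.snoc_last]; rfl
  have hnc : ∀ j, n (Fin.castSucc j) = (e j, 0) := fun j => by simp only [n, Fin.snoc_castSucc]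
  have hnl : n (Fin.last 3) = (a, b) := by simp only [n, Fin.snoc_last]
  have hf : ∀ (p q : E3) (s t : ℝ), form (p, s) (q, t) = ⟪p, q⟫ - s * t := fun _ _ _ _ => rfl
  refine ⟨⟨V, n, fun i => ?_, fun i j hij => ?_, fun i => ?_⟩, ?_, hnc, fun i => ?_⟩
  · rcases hcases i with rfl | ⟨i, rfl⟩
    · rw [hnl, hf, haa, ← hb2]; ring
    · rw [hnc, hf, he]
      fin_cases i <;> simp [cornerGram]
  · rcases hcases i with rfl | ⟨i, rfl⟩ <;> rcases hcases j with rfl | ⟨j, rfl⟩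
    · exact absurd rfl hij
    · rw [hVc, hnl, hf, hvab]; ring
    · rw [hVl, hnc, hf, inner_zero_left]; ring
    · rw [hVc, hnc, hf, hve, if_neg fun h => hij (by rw [h])]; ring
  · rcases hcases i with rfl | ⟨i, rfl⟩
    · rw [hVl, hnl, hf, inner_zero_left]; linarith
    · rw [hVc, hnc, hf, hve, if_pos rfl]
      have := div_pos_of_neg_of_neg hbneg (hc i)
      linarith
  · exact congrArg Prod.fst hVl
  · change form (n i.castSucc) (n (Fin.last 3)) = g i
    rw [hnc, hnl, hf, real_inner_comm, hae]; ring

lemma Tetrahedron.hasType_of_normals {T : Tetrahedron} {m : ℕ} (hm : 1 ≤ m)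
    (h1 : ∀ i : Fin 3, T.normal i.castSucc = (stdCorner i, 0))
    (h2 : ∀ i : Fin 3, form (T.normal i.castSucc) (T.normal 3) =
      (![0, -(1 / 2), -Real.cos (Real.pi / m)] : Fin 3 → ℝ) i) : T.HasType 2 3 m 2 3 5 := by
  have hG : ∀ i j : Fin 3, form (T.normal i.castSucc) (T.normal j.castSucc) = cornerGram i j :=
    fun i j => by rw [h1, h1, ← isCornerFrame_stdCorner i j]; simp [form]
  have key : ∀ {i j : Fin 4} {k : ℕ}, 1 ≤ k →
      form (T.normal i) (T.normal j) = -Real.cos (Real.pi / k) →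
      T.dihedralAngle i j = Real.pi / k := by
    intro i j k hk h
    have hk' : (1 : ℝ) ≤ k := by exact_mod_cast hk
    rw [dihedralAngle, h, neg_neg, Real.arccos_cos (by positivity)
      (div_le_self Real.pi_pos.le hk')]
  have c5 : Real.cos (Real.pi / (5 : ℕ)) = goldenRatio / 2 := by
    exact_mod_cast cos_pi_div_five_eq
  have c3 : Real.cos (Real.pi / (3 : ℕ)) = 1 / 2 := by exact_mod_cast Real.cos_pi_div_three
  have c2 : Real.cos (Real.pi / (2 : ℕ)) = 0 := by exact_mod_cast Real.cos_pi_div_two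
  refine ⟨key (by norm_num) ((h2 0).trans ?_), key (by norm_num) ((h2 1).trans ?_),
    key hm ((h2 2).trans ?_), key (by norm_num) ((hG 1 2).trans ?_),
    key (by norm_num) ((hG 0 2).trans ?_), key (by norm_num) ((hG 0 1).trans ?_)⟩
  · rw [c2]; simp
  · rw [c3]; rfl
  · rfl
  · rw [c2]; simp [cornerGram]
  · rw [c3]; rfl
  · rw [c5]; rfl

/-- The vertices of the tetrahedron lie in the open ball. The difference of the two sides is
`(φ + 1) (3 - 4 x ^ 2)` for the first two vertices and `1` for the third one. -/
lemma faceHeight_mul_cornerInv_lt {x : ℝ} (hx : x ^ 2 ≤ 1 / 2) (j : Fin 3) :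
    faceHeight x * cornerInv j j < faceCoeff x j ^ 2 := by
  have hp := Real.goldenRatio_sq
  have h0 : 0 < (goldenRatio + 1) * (3 - 4 * x ^ 2) :=
    mul_pos (by linarith [Real.goldenRatio_pos]) (by linarith)
  rw [← sub_pos]
  fin_cases j <;>
    simp only [faceHeight, faceCoeff, cornerInv, Matrix.of_apply, Fin.reduceFinMk, Fin.zero_eta,
      Fin.mk_one, Matrix.cons_val]
  · refine h0.trans_eq ?_
    linear_combination (-1 : ℝ) * hp
  · refine h0.trans_eq ?_
    linear_combination -x ^ 2 * hp
  · refine one_pos.trans_eq ?_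
    linear_combination -(1 / 4 : ℝ) * hp

theorem exists_tetrahedra : ∃ T₂ T₄ : Tetrahedron,
    T₂.HasType 2 3 2 2 3 5 ∧ T₄.HasType 2 3 4 2 3 5 ∧ T₂.SharesCorner T₄ := by
  obtain ⟨T₂, v₂, n₂, f₂⟩ := exists_tetrahedron le_rfl
    (faceHeight_mul_cornerInv_lt (by norm_num))
  obtain ⟨T₄, v₄, n₄, f₄⟩ := exists_tetrahedron (by linarith [cos_pi_div_four_bounds.1])
    (faceHeight_mul_cornerInv_lt (by rw [Real.cos_pi_div_four, div_pow, Real.sq_sqrt] <;> norm_num))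
  refine ⟨T₂, T₄, Tetrahedron.hasType_of_normals (by norm_num) n₂ ?_,
    Tetrahedron.hasType_of_normals (by norm_num) n₄ ?_, v₂, v₄, fun i hi => ?_⟩
  · have hx : Real.cos (Real.pi / (2 : ℕ)) = 0 := by exact_mod_cast Real.cos_pi_div_two
    rw [hx]; exact f₂
  · have hx : Real.cos (Real.pi / (4 : ℕ)) = Real.cos (Real.pi / 4) := by norm_num
    rw [hx]; exact f₄
  · obtain ⟨j, rfl⟩ : ∃ j : Fin 3, j.castSucc = i := Fin.exists_castSucc_eq.2 hi
    rw [n₂, n₄]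

end Agol

end

theorem theorem4p2 :
    (∃ T₂ T₄ : Agol.Tetrahedron,
      T₂.HasType 2 3 2 2 3 5 ∧ T₄.HasType 2 3 4 2 3 5 ∧ T₂.SharesCorner T₄) ∧
    ∀ T₂ T₄ : Agol.Tetrahedron,
      T₂.HasType 2 3 2 2 3 5 → T₄.HasType 2 3 4 2 3 5 → T₂.SharesCorner T₄ →
      ∃ (K : ℝ) (h : Agol.E3 →ₗ[ℝ] Agol.E3)
        (f : Agol.OrbifoldMap T₄.rotationGroup T₂.rotationGroup),
        K < 1 ∧ K ≤ 0.977 ∧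
        -- the linear map
        (∀ i, h (T₄.vert i).val = (T₂.vert i).val) ∧
        h '' T₄.carrier = T₂.carrier ∧
        (∀ x y : Agol.Klein, ∃ x' y' : Agol.Klein,
          x'.val = h x.val ∧ y'.val = h y.val ∧ x'.dist y' ≤ K * x.dist y) ∧
        -- the map of orbifolds comes from the linear map
        (∀ x : Agol.Klein, x.val ∈ T₄.carrier → (f.lift x).val = h x.val) ∧
        (∀ (i : Fin 4) (x : Agol.Klein), f.lift (T₄.refl i • x) = T₂.refl i • f.lift x) ∧
        -- it is Lipschitz and has degree one
        (∀ x y : Agol.Klein, (f.lift x).dist (f.lift y) ≤ K * x.dist y) ∧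
        (∀ p q : Agol.Orbifold T₄.rotationGroup,
          Agol.Orbifold.dist (f.map p) (f.map q) ≤ K * Agol.Orbifold.dist p q) ∧
        f.HasDegree 1 := by
  refine ⟨Agol.exists_tetrahedra, fun T₂ T₄ h₂ h₄ hc => ?_⟩
  obtain ⟨h, hdet⟩ := Agol.Tetrahedron.exists_contraction h₂ h₄ hc
  have hT₂ := h₂.isCoxeter le_rfl
  have hT₄ := h₄.isCoxeter (by norm_num)
  -- the relations of the group of `T₄` hold in the group of `T₂`, because `2` divides `4`
  have hM := Agol.Tetrahedron.isLiftable_cornerMatrix_of_dvd (m := 4) (hm := by norm_num)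
    (by norm_num : 2 ∣ 4) hT₂.isLiftable
  have hlip : ∀ x y, ((h.orbifoldMap hT₄ hM).lift x).dist ((h.orbifoldMap hT₄ hM).lift y) ≤
      0.977 * x.dist y :=
    Agol.Klein.dist_le_of_eventually (h.continuous_extend hT₄ hM)
      (h.eventually_dist_extend_le hT₄ hM)
  refine ⟨0.977, h.map, h.orbifoldMap hT₄ hM, by norm_num, le_rfl, h.map_vert, h.image_carrier,
    fun x y => ⟨h.kleinMap x, h.kleinMap y, rfl, rfl, h.dist_kleinMap_le x y⟩, fun x hx => ?_,
    fun i x => ?_, hlip, (h.orbifoldMap hT₄ hM).dist_map_le h.nonneg hlip,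
    h.hasDegree_one hT₄ hM hT₂ hdet⟩
  · exact congrArg Agol.Klein.val
      (h.extend_of_mem hT₄ hM (Agol.Tetrahedron.mem_innerCone_of_mem_carrier hx))
  · have := h.extend_smul hT₄ hM ((Agol.cornerMatrix 4 (by norm_num)).toCoxeterSystem.simple i) x
    rwa [Agol.Tetrahedron.rep_simple, Agol.Tetrahedron.rep_simple] at this
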